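/- Fix a finite set $G$ of quantum gates, each an admissible (completely positive, trace-preserving) operation from $k$ qubits to $l$ qubits whose matrix, as a linear map, has efficiently approximable entries. For constants $0\le b<a\le 2$ let $\mathrm{QCD}_{a,b}$ be the promise problem whose input is (a description of) a pair $(Q_0,Q_1)$ of mixed-state quantum circuits over $G$ of the same type $(n,m)$ ($n$ input and $m$ output qubits), the yes-instances being those with $\|Q_0-Q_1\|_\diamond\ge a$ and the no-instances those with $\|Q_0-Q_1\|_\diamond\le b$. Here $\|\Phi\|_\diamond=\max\{\|(\Phi\otimes I_n)(X)\|_{\mathrm{tr}} : \|X\|_{\mathrm{tr}}=1\}$ for $\Phi$ acting on $n$ qubits, and $\|\cdot\|_{\mathrm{tr}}$ is the sum of the singular values. Let $\mathrm{QIP}$ be the class of promise problems that have a quantum interactive proof system: a polynomial-time algorithm maps each input $x$ to the mixed-state circuits (over some finite gate set with efficiently approximable entries) of a verifier exchanging polynomially many messages with a prover, such that, for some constants $0\le s<c\le1$, some prover makes the verifier accept with probability at least $c$ on every yes-instance, and no prover makes it accept with probability more than $s$ on a no-instance. Provers may hold any number of private qubits and perform arbitrary admissible operations. The *blind taste-test*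 verifier for $(Q_0,Q_1)$ (1) receives an $n$-qubit register from the prover; (2) chooses $i\in\{0,1\}$ uniformly, applies $Q_i$ to the register and sends the resulting $m$-qubit register to the prover; (3) receives a bit $j$ (one qubit, measured in the standard basis) and accepts if and only if $i=j$. **Theorem.** Let $a,b$ be constants with $0\le b<a\le2$. Then $\mathrm{QCD}_{a,b}\in\mathrm{QIP}$. Moreover, the blind taste-test verifiers, given by circuits computable in polynomial time from $(Q_0,Q_1)$, form a three-message quantum interactive proof system for $\mathrm{QCD}_{a,b}$ in which some prover is accepted with probability at least $\frac12+\frac a4$ on each yes-instance and every prover is accepted with probability at most $\frac12+\frac b4$ on each no-instance. For all circuits $Q_0,Q_1$ over $G$ of the same type, the maximum probability with which a prover can cause the blind taste-test verifier to accept is exactly $$\frac12+\frac14\,\|Q_0-Q_1\|_\diamond .$$ -/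

import Mathlib

namespace QIPDefs

open scoped ComplexOrder

noncomputable section

/-! ### Operators, transformations and admissible operations -/

/-- Labels of the standard basis of an `n`-qubit space: binary strings of length `n`. -/
abbrev Bits (n : ℕ) : Type := Fin n → Bool

/-- Linear operators on the Hilbert space with standard basis `I`. -/
abbrev Op (I : Type) : Type := Matrix I I ℂ

/-- Transformations: linear maps from operators on `I` to operators on `J`. -/
abbrev Transf (I J : Type) : Type := Op I →ₗ[ℂ] Op J

/-- Density matrices: positive semidefinite operators with unit trace. -/
def IsDensity {I : Type} [Fintype I] (ρ : Op I) : Prop := ρ.PosSemidef ∧ ρ.trace = 1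

/-- `Φ ⊗ id`, the transformation `Φ` performed on the first part of a system `I × K`. -/
def ampR {I J : Type} (K : Type) (Φ : Transf I J) : Transf (I × K) (J × K) where
  toFun X := Matrix.of fun x y => Φ (Matrix.of fun i i' => X (i, x.2) (i', y.2)) x.1 y.1
  map_add' X Y := by
    ext x y
    exact congrFun (congrFun (map_add Φ (Matrix.of fun i i' => X (i, x.2) (i', y.2))
      (Matrix.of fun i i' => Y (i, x.2) (i', y.2))) x.1) y.1
  map_smul' r X := by
    ext x y
    exact congrFun (congrFun (map_smul Φ r
      (Matrix.of fun i i' => X (i, x.2) (i', y.2))) x.1) y.1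

/-- `id ⊗ Φ`, the transformation `Φ` performed on the second part of a system `K × I`. -/
def ampL {I J : Type} (K : Type) (Φ : Transf I J) : Transf (K × I) (K × J) where
  toFun X := Matrix.of fun x y => Φ (Matrix.of fun i i' => X (x.1, i) (y.1, i')) x.2 y.2
  map_add' X Y := by
    ext x y
    exact congrFun (congrFun (map_add Φ (Matrix.of fun i i' => X (x.1, i) (y.1, i'))
      (Matrix.of fun i i' => Y (x.1, i) (y.1, i'))) x.2) y.2
  map_smul' r X := by
    ext x y
    exact congrFun (congrFun (map_smul Φ r
      (Matrix.of fun i i' => X (x.1, i) (y.1, i'))) x.2) y.2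

/-- The tensor product `Φ ⊗ Ψ` of two transformations. -/
def tensor {I J I' J' : Type} (Φ : Transf I J) (Ψ : Transf I' J') :
    Transf (I × I') (J × J') :=
  ampR J' Φ ∘ₗ ampL I Ψ

/-- The transformation that renames the standard basis along a bijection. -/
def rename {I J : Type} (e : I ≃ J) : Transf I J :=
  (Matrix.reindexLinearEquiv ℂ ℂ e e).toLinearMap

/-- An operation is admissible if, performed on the first part of a system consisting of its input
and `m` further qubits, for arbitrary `m`, it maps density matrices to density matrices. -/
def IsAdmissible {I J : Type} [Fintype I] [Fintype J] (Φ : Transf I J) : Prop :=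
  ∀ (m : ℕ) (ρ : Op (I × Bits m)), IsDensity ρ → IsDensity (ampR (Bits m) Φ ρ)

/-! ### Trace norm and diamond norm -/

/-- The trace norm: the sum of the singular values, that is, of the square roots of the
eigenvalues of `X† X`. -/
def traceNorm {I : Type} [Fintype I] [DecidableEq I] (X : Op I) : ℝ :=
  ∑ i, √((Matrix.isHermitian_conjTranspose_mul_self X).eigenvalues i)

/-- The trace norm of a transformation: `max {‖Φ(X)‖_tr : ‖X‖_tr = 1}`. -/
def transfTraceNorm {I J : Type} [Fintype I] [DecidableEq I] [Fintype J] [DecidableEq J]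
    (Φ : Transf I J) : ℝ :=
  sSup {r : ℝ | ∃ X : Op I, traceNorm X = 1 ∧ traceNorm (Φ X) = r}

/-- The diamond norm `‖Φ ⊗ id‖_tr`, the identity being on a space of the dimension of the input. -/
def diamondNorm {I J : Type} [Fintype I] [DecidableEq I] [Fintype J] [DecidableEq J]
    (Φ : Transf I J) : ℝ :=
  transfTraceNorm (ampR I Φ)

/-! ### Polynomial time and efficiently approximable numbers -/

/-- Functions on binary strings computable by a Turing machine in polynomial time. -/
def PolyTime (f : List Bool → List Bool) : Prop :=
  Nonempty (Turing.TM2ComputableInPolyTime (id : List Bool → List Bool) id f)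

/-- Functions on natural numbers for which the value at `t` (written in binary) is computable in
time polynomial in `t`. -/
def PolyTimeNat (p : ℕ → ℕ) : Prop :=
  Nonempty (Turing.TM2ComputableInPolyTime Computability.unaryEncodeNat Computability.encodeNat p)

/-- A real number is efficiently approximable if a rational number within distance `2⁻ᵗ` of it can
be computed in time polynomial in `t`. -/
def EffApproxReal (x : ℝ) : Prop :=
  ∃ p q r : ℕ → ℕ, PolyTimeNat p ∧ PolyTimeNat q ∧ PolyTimeNat r ∧
    ∀ t, 0 < r t ∧ |x - ((p t : ℝ) - (q t : ℝ)) / (r t : ℝ)| ≤ ((2 : ℝ) ^ t)⁻¹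

/-- A complex number is efficiently approximable if its real and imaginary parts are. -/
def EffApprox (z : ℂ) : Prop := EffApproxReal z.re ∧ EffApproxReal z.im

/-! ### Mixed-state quantum circuits -/

/-- A finite set of quantum gates: `size` many gates, each of a type `(inputs, outputs)` and given
by an admissible operation of that type. -/
structure GateSet where
  size : ℕ
  inputs : Fin size → ℕ
  outputs : Fin size → ℕ
  op : ∀ g, Transf (Bits (inputs g)) (Bits (outputs g))
  admissible : ∀ g, IsAdmissible (op g)

/-- A finite gate set is reasonable if the matrices of its gates, as linear mappings, consist of
efficiently approximable numbers. -/
def GateSet.Reasonable (G : GateSet) : Prop :=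
  ∀ (g : Fin G.size) (i i' : Bits (G.inputs g)) (j j' : Bits (G.outputs g)),
    EffApprox (G.op g (Matrix.single i i' 1) j j')

/-- Mixed-state quantum circuits of type `(n, m)` over the gate set `G`, presented as circuit
diagrams: gates, `n` bare wires, a bundle of `a` wires crossing a bundle of `b` wires, and diagrams
composed in sequence or placed in parallel. -/
inductive Circuit (G : GateSet) : ℕ → ℕ → Type
  | gate (g : Fin G.size) : Circuit G (G.inputs g) (G.outputs g)
  | wires (n : ℕ) : Circuit G n n
  | cross (a b : ℕ) : Circuit G (a + b) (b + a)
  | seq {n k m : ℕ} (c : Circuit G n k) (d : Circuit G k m) : Circuit G n m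
  | par {n m n' m' : ℕ} (c : Circuit G n m) (d : Circuit G n' m') : Circuit G (n + n') (m + m')

/-- Splitting a register of `a + b` qubits into the first `a` and the last `b` qubits. -/
def splitBits (a b : ℕ) : Bits (a + b) ≃ Bits a × Bits b := (Fin.appendEquiv a b).symm

/-- The operation of type `(n, m)` specified by a circuit of type `(n, m)`. -/
def Circuit.op {G : GateSet} : {n m : ℕ} → Circuit G n m → Transf (Bits n) (Bits m)
  | _, _, .gate g => G.op g
  | _, _, .wires _ => LinearMap.id
  | _, _, .cross a b =>
      rename ((splitBits a b).trans ((Equiv.prodComm _ _).trans (splitBits b a).symm))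
  | _, _, .seq c d => d.op ∘ₗ c.op
  | _, _, @Circuit.par _ n m n' m' c d =>
      rename (splitBits m m').symm ∘ₗ tensor c.op d.op ∘ₗ rename (splitBits n n')

/-- The self-delimiting unary code of a number. -/
def unary (n : ℕ) : List Bool := List.replicate n true ++ [false]

/-- The description of a circuit as a binary string, in prefix notation; gate indices and numbers of
wires are written in unary, so large circuits have no compact descriptions. -/
def Circuit.encode {G : GateSet} : {n m : ℕ} → Circuit G n m → List Bool
  | _, _, .gate g => [false, false] ++ unary g
  | _, _, .wires n => [false, true, false] ++ unary n
  | _, _, .cross a b => [false, true, true] ++ unary a ++ unary b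
  | _, _, .seq c d => [true, false] ++ c.encode ++ d.encode
  | _, _, .par c d => [true, true] ++ c.encode ++ d.encode

theorem unary_append_inj {n n' : ℕ} {s t : List Bool} (h : unary n ++ s = unary n' ++ t) :
    n = n' ∧ s = t := by
  induction n generalizing n' with
  | zero =>
    cases n' with
    | zero => exact ⟨rfl, by simpa [unary] using h⟩
    | succ k => simp [unary, List.replicate_succ] at h
  | succ k ih =>
    cases n' with
    | zero => simp [unary, List.replicate_succ] at h
    | succ k' =>
      have h2 : unary k ++ s = unary k' ++ t := by
        simpa [unary, List.replicate_succ] using h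
      exact ⟨congrArg Nat.succ (ih h2).1, (ih h2).2⟩

/-- Descriptions of circuits are uniquely readable. -/
theorem Circuit.encode_append_inj {G : GateSet} {n m : ℕ} (c : Circuit G n m) :
    ∀ {n' m' : ℕ} (c' : Circuit G n' m') (s t : List Bool), c.encode ++ s = c'.encode ++ t →
      (n = n' ∧ m = m' ∧ HEq c c') ∧ s = t := by
  induction c with
  | gate g =>
    intro n' m' c' s t h
    cases c' <;> simp [Circuit.encode] at h
    obtain ⟨h1, h2⟩ := unary_append_inj h
    obtain rfl := Fin.ext h1
    exact ⟨⟨rfl, rfl, HEq.rfl⟩, h2⟩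
  | wires n =>
    intro n' m' c' s t h
    cases c' <;> simp [Circuit.encode] at h
    obtain ⟨rfl, h2⟩ := unary_append_inj h
    exact ⟨⟨rfl, rfl, HEq.rfl⟩, h2⟩
  | cross a b =>
    intro n' m' c' s t h
    cases c' <;> simp [Circuit.encode] at h
    obtain ⟨rfl, h2⟩ := unary_append_inj h
    obtain ⟨rfl, h3⟩ := unary_append_inj h2
    exact ⟨⟨rfl, rfl, HEq.rfl⟩, h3⟩
  | seq c d ihc ihd =>
    intro n' m' c' s t h
    cases c' <;> simp [Circuit.encode] at h
    obtain ⟨⟨rfl, rfl, h1⟩, h2⟩ := ihc _ _ _ h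
    obtain rfl := eq_of_heq h1
    obtain ⟨⟨_, rfl, h3⟩, h4⟩ := ihd _ _ _ h2
    obtain rfl := eq_of_heq h3
    exact ⟨⟨rfl, rfl, HEq.rfl⟩, h4⟩
  | par c d ihc ihd =>
    intro n' m' c' s t h
    cases c' <;> simp [Circuit.encode] at h
    obtain ⟨⟨rfl, rfl, h1⟩, h2⟩ := ihc _ _ _ h
    obtain rfl := eq_of_heq h1
    obtain ⟨⟨rfl, rfl, h3⟩, h4⟩ := ihd _ _ _ h2
    obtain rfl := eq_of_heq h3
    exact ⟨⟨rfl, rfl, HEq.rfl⟩, h4⟩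

/-! ### Promise problems and quantum circuit distinguishability -/

/-- A promise problem: two disjoint sets of binary strings. -/
structure PromiseProblem where
  yes : Set (List Bool)
  no : Set (List Bool)
  disjoint : Disjoint yes no

/-- The description of a pair of circuits of the same type `(n, m)`. -/
def encodePair {G : GateSet} {n m : ℕ} (Q₀ Q₁ : Circuit G n m) : List Bool :=
  unary n ++ unary m ++ Q₀.encode ++ Q₁.encode

theorem encodePair_inj {G : GateSet} {n m n' m' : ℕ} {Q₀ Q₁ : Circuit G n m}
    {R₀ R₁ : Circuit G n' m'} (h : encodePair Q₀ Q₁ = encodePair R₀ R₁) :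
    n = n' ∧ m = m' ∧ HEq Q₀ R₀ ∧ HEq Q₁ R₁ := by
  simp only [encodePair, List.append_assoc] at h
  obtain ⟨rfl, h⟩ := unary_append_inj h
  obtain ⟨rfl, h⟩ := unary_append_inj h
  obtain ⟨⟨_, _, h0⟩, h⟩ := Q₀.encode_append_inj _ _ _ h
  obtain ⟨⟨_, _, h1⟩, _⟩ := Q₁.encode_append_inj R₁ [] [] (by simpa using h)
  exact ⟨rfl, rfl, h0, h1⟩

/-- The quantum circuit distinguishability problem with parameters `b < a`, for mixed-state quantum
circuits over the gate set `G`. -/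
def QCD (G : GateSet) (a b : ℝ) (hab : b < a) : PromiseProblem where
  yes := {x | ∃ (n m : ℕ) (Q₀ Q₁ : Circuit G n m),
    x = encodePair Q₀ Q₁ ∧ a ≤ diamondNorm (Q₀.op - Q₁.op)}
  no := {x | ∃ (n m : ℕ) (Q₀ Q₁ : Circuit G n m),
    x = encodePair Q₀ Q₁ ∧ diamondNorm (Q₀.op - Q₁.op) ≤ b}
  disjoint := by
    rw [Set.disjoint_left]
    rintro x ⟨n, m, Q₀, Q₁, hx, hQ⟩ ⟨n', m', R₀, R₁, hx', hR⟩
    obtain ⟨rfl, rfl, h0, h1⟩ := encodePair_inj (hx.symm.trans hx')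
    obtain rfl := eq_of_heq h0
    obtain rfl := eq_of_heq h1
    linarith

/-! ### Quantum interactive proof systems -/

/-- The actions of a verifier, from the moment when it holds `v` private qubits and waits for a
message of the prover.  It either receives the last message, of `p` qubits, and performs an
operation whose output qubit is measured, or it receives `p` qubits, performs an operation, sends a
message of `q` qubits, keeps `v'` private qubits, and goes on.  (A verifier that sends the first
message is one that first receives a message of zero qubits.) -/
inductive Verifier : ℕ → Type
  | decide {v : ℕ} (p : ℕ) (D : Transf (Bits v × Bits p) (Bits 1)) : Verifier v
  | round {v : ℕ} (p q v' : ℕ) (R : Transf (Bits v × Bits p) (Bits v' × Bits q))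
      (next : Verifier v') : Verifier v

/-- The number of messages that are still to be exchanged. -/
def Verifier.messages : {v : ℕ} → Verifier v → ℕ
  | _, .decide _ _ => 1
  | _, .round _ _ _ _ next => next.messages + 2

/-- Strategies of a prover that has just received `q` qubits and holds `w` private qubits.  In each
turn the prover performs an arbitrary admissible operation on these qubits, whose output consists of
the next message and of private qubits, in an arbitrary number `w'`. -/
inductive Verifier.Strategy : {v : ℕ} → Verifier v → (q w : ℕ) → Type
  | decide {v p q w : ℕ} {D : Transf (Bits v × Bits p) (Bits 1)} (w' : ℕ)
      (Φ : Transf (Bits q × Bits w) (Bits p × Bits w')) (hΦ : IsAdmissible Φ) :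
      Strategy (.decide p D) q w
  | round {v p q' v' q w : ℕ} {R : Transf (Bits v × Bits p) (Bits v' × Bits q')}
      {next : Verifier v'} (w' : ℕ)
      (Φ : Transf (Bits q × Bits w) (Bits p × Bits w')) (hΦ : IsAdmissible Φ)
      (S : Strategy next q' w') :
      Strategy (.round p q' v' R next) q w

/-- The action of both parties in one turn, on the verifier's private qubits `V`, the qubits `Q` of
the message just sent to the prover, and the prover's private qubits `W`: the prover applies `Φ`,
then the verifier applies `R`. -/
def turn {V Q W P W' O : Type} (Φ : Transf (Q × W) (P × W')) (R : Transf (V × P) O)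
    (ρ : Op (V × (Q × W))) : Op (O × W') :=
  ampR W' R (rename (Equiv.prodAssoc V P W').symm (ampL V Φ ρ))

/-- The probability that measuring the first qubit of a state on `Bits 1 × W` yields `1`. -/
def probOne {W : Type} [Fintype W] (ρ : Op (Bits 1 × W)) : ℝ :=
  ∑ w, (ρ (fun _ => true, w) (fun _ => true, w)).re

/-- The probability of acceptance, from a given joint state of the verifier's private qubits, the
message just sent to the prover, and the prover's private qubits. -/
def Verifier.acceptFrom : {v : ℕ} → {V : Verifier v} → {q w : ℕ} → V.Strategy q w →
    Op (Bits v × (Bits q × Bits w)) → ℝ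
  | _, .decide _ D, _, _, .decide _ Φ _, ρ => probOne (turn Φ D ρ)
  | _, .round _ q' v' R _, _, _, .round w' Φ _ S, ρ =>
      acceptFrom S (rename (Equiv.prodAssoc (Bits v') (Bits q') (Bits w')) (turn Φ R ρ))

/-- Strategies of a prover for the whole interaction, which begins with no qubits at all. -/
abbrev Verifier.Prover (V : Verifier 0) : Type := V.Strategy 0 0

/-- The probability that a prover causes the verifier to accept. -/
def Verifier.acceptProb (V : Verifier 0) (P : V.Prover) : ℝ := Verifier.acceptFrom P 1

/-- Verifiers whose operations are given by mixed-state quantum circuits over the gate set `G`. -/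
inductive VerifierCircuits (G : GateSet) : ℕ → Type
  | decide {v : ℕ} (p : ℕ) (c : Circuit G (v + p) 1) : VerifierCircuits G v
  | round {v : ℕ} (p q v' : ℕ) (c : Circuit G (v + p) (v' + q))
      (next : VerifierCircuits G v') : VerifierCircuits G v

/-- The verifier described by a list of circuits. -/
def VerifierCircuits.toVerifier {G : GateSet} : {v : ℕ} → VerifierCircuits G v → Verifier v
  | v, .decide p c => .decide p (c.op ∘ₗ rename (splitBits v p).symm)
  | v, .round p q v' c next =>
      .round p q v' (rename (splitBits v' q) ∘ₗ c.op ∘ₗ rename (splitBits v p).symm)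
        next.toVerifier

/-- The description of the circuits of a verifier as a binary string. -/
def VerifierCircuits.encode {G : GateSet} : {v : ℕ} → VerifierCircuits G v → List Bool
  | _, .decide p c => [false] ++ unary p ++ c.encode
  | _, .round p q v' c next =>
      [true] ++ unary p ++ unary q ++ unary v' ++ c.encode ++ next.encode

/-- `f` generates a quantum interactive proof system for the promise problem `A`, with verifier
circuits over `G`, with `μ(|x|)` messages on input `x`, with completeness probability `c` and
soundness probability `s`: a polynomial-time function that maps `x` to a description of a verifier
which some prover causes to accept with probability at least `c` if `x` is a yes-instance, and which
every prover causes to accept with probability at most `s` if `x` is a no-instance. -/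
def IsProofSystem (G : GateSet) (f : List Bool → List Bool) (A : PromiseProblem) (μ : ℕ → ℕ)
    (c s : ℝ) : Prop :=
  PolyTime f ∧ ∀ x ∈ A.yes ∪ A.no, ∃ W : VerifierCircuits G 0,
    f x = W.encode ∧ W.toVerifier.messages = μ x.length ∧
    (x ∈ A.yes → ∃ P : W.toVerifier.Prover, c ≤ W.toVerifier.acceptProb P) ∧
    (x ∈ A.no → ∀ P : W.toVerifier.Prover, W.toVerifier.acceptProb P ≤ s)

/-- The class of promise problems that have quantum interactive proof systems, with circuits over
some reasonable finite gate set, polynomially many messages, and constant completeness and soundness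
probabilities `c > s`. -/
def QIP : Set PromiseProblem :=
  {A | ∃ (G : GateSet) (f : List Bool → List Bool) (μ : ℕ → ℕ) (N : Polynomial ℕ) (c s : ℝ),
    G.Reasonable ∧ (∀ l, μ l ≤ N.eval l) ∧ 0 ≤ s ∧ s < c ∧ c ≤ 1 ∧ IsProofSystem G f A μ c s}

/-! ### The blind taste-test -/

/-- Storing the classical bit `i` in a new qubit in front of a register: `X ↦ |i⟩⟨i| ⊗ X`. -/
def attachBit {I : Type} (i : Bool) : Transf I (Bits 1 × I) :=
  Matrix.kroneckerMapBilinear (LinearMap.mul ℂ ℂ)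
    (Matrix.single (fun _ => i) (fun _ => i) 1 : Op (Bits 1))

/-- The second step of the blind taste-test: `i ∈ {0, 1}` is chosen uniformly, `Φ_i` is applied to
the received register, the result is sent, and `i` is kept:
`X ↦ ½ |0⟩⟨0| ⊗ Φ₀(X) + ½ |1⟩⟨1| ⊗ Φ₁(X)`. -/
def tasteChallenge {n m : ℕ} (Φ₀ Φ₁ : Transf (Bits n) (Bits m)) :
    Transf (Bits 0 × Bits n) (Bits 1 × Bits m) :=
  ((1 / 2 : ℂ) • (attachBit false ∘ₗ Φ₀) + (1 / 2 : ℂ) • (attachBit true ∘ₗ Φ₁)) ∘ₗ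
    rename (Equiv.uniqueProd (Bits n) (Bits 0))

/-- The last step of the blind taste-test: the prover's answer `j` is measured and compared with
`i`; the output qubit is `1` if `i = j` and `0` otherwise. -/
def tasteDecision : Transf (Bits 1 × Bits 1) (Bits 1) where
  toFun X := Matrix.diagonal fun out =>
    ∑ i : Bool, ∑ j : Bool,
      if (i == j) = out 0 then X (fun _ => i, fun _ => j) (fun _ => i, fun _ => j) else 0
  map_add' X Y := by
    ext x y
    by_cases h : x = y
    · subst h
      simp only [Matrix.diagonal_apply_eq, Matrix.add_apply, ← Finset.sum_add_distrib]
      refine Finset.sum_congr rfl fun i _ => Finset.sum_congr rfl fun j _ => ?_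
      split_ifs <;> simp
    · simp [Matrix.diagonal_apply_ne _ h]
  map_smul' r X := by
    ext x y
    by_cases h : x = y
    · subst h
      simp only [Matrix.diagonal_apply_eq, Matrix.smul_apply, RingHom.id_apply, smul_eq_mul,
        Finset.mul_sum]
      refine Finset.sum_congr rfl fun i _ => Finset.sum_congr rfl fun j _ => ?_
      split_ifs <;> simp
    · simp [Matrix.diagonal_apply_ne _ h]

/-- The verifier of the blind taste-test for two operations of type `(n, m)`: receive an `n`-qubit
register, send back the `m`-qubit register to which a uniformly random one of the operations has
been applied, receive one qubit and accept if it tells which operation was applied. -/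
def blindTasteTest {n m : ℕ} (Φ₀ Φ₁ : Transf (Bits n) (Bits m)) : Verifier 0 :=
  .round n m 1 (tasteChallenge Φ₀ Φ₁) (.decide 1 tasteDecision)

end

end QIPDefs

open QIPDefs

/-!
The maximum acceptance probability. A prover of the blind taste-test sends a part of a state `ρ`,
and holds `(Q_i ⊗ id) ρ` after the challenge. Its answer is a two-outcome measurement, so it is
accepted with probability `1/2 + ℓ ((Δ ⊗ id) ρ) / 2`, where `Δ = Q₀ - Q₁` and where `ℓ` is the
probability of the answer `0` (`acceptProb_blindTasteTest`). It has to be shown that the maximum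
of `ℓ ((Δ ⊗ id) ρ)`, over all states and all such tests, is half the diamond norm of `Δ`
(`exists_diamondNorm`). By compactness, there is a maximum `M` among pure states of two copies of
the input space and projective measurements (`exists_optimal_pure`). By the Schmidt decomposition
(`exists_schmidt`), private spaces larger than the input space are of no use, and the best test
for a Hermitian operator is the projection on its positive part, so `M` bounds all tests and all
states (`test_density_le`). As `Δ ⊗ id` maps states to traceless Hermitian operators, the best
test attains half the trace norm (`exists_best_test`), whence `2 M ≤ ‖Δ‖_⋄`. Conversely, let `X`
have trace norm one. By its singular value decomposition and by duality with contractions `C`, it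
suffices to bound `Re tr (C (Δ ⊗ id)(|u⟩⟨w|))` for vectors `u` and `w`. That number is the value
of a test (`exists_offDiagonal_test`) on the pure state `|u⟩|0⟩ + |w⟩|1⟩`, which has one more
private qubit (`re_trace_mul_ampR_le`). So `‖(Δ ⊗ id)(X)‖_tr ≤ 2 M` (`traceNorm_ampR_le`), also
for operators `X` that are not Hermitian.

The verifier as a circuit. The gate set is extended by four gates: a coin, the routing of a qubit
to one of two places, the selection of one of two qubits, and the comparison of two bits. To apply
`Q_i` for a random `i`, the register is routed to the circuit `Q_i`, the other circuit receiving
zeros, and the output of `Q_i` is selected. This is correct because circuits preserve traces,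
which makes the discarded output harmless (`challengeCircuit_op`, `tasteVerifier_toVerifier`).

Polynomial time. A small language of stack programs compiles to Turing machines with the same
running time up to one step (`StackProg.polyTime_of_runsIn`). The description of the verifier
consists of the descriptions of `Q₀` and `Q₁`, which are copied from the input, between two
strings that depend on `n` and `m` only and that loops emit in quadratic time
(`polyTime_reduction`).
-/

namespace BlindTaste

section StackPrograms

open Turing StateTransition

/-! ### Structured stack programs and their Turing machines -/

/-- Programs acting on finitely many stacks of bits. -/
inductive StackProg (K : Type) : Type
  /-- put the string `s` on top of the stack `k` -/
  | emit (k : K) (s : List Bool)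
  /-- pop all symbols of `k` and push them, in the order of popping, on `k'` -/
  | move (k k' : K)
  /-- pop `k` and run the body `P`, again and again, until the popped symbol is not `true` -/
  | loop (k : K) (P : StackProg K)
  | seq (P Q : StackProg K)

namespace StackProg

variable {K : Type}

/-- The labels of the Turing machine code of a program. -/
def Label : StackProg K → Type
  | emit _ _ => Unit
  | move _ _ => Unit
  | loop _ P => Option P.Label
  | seq P Q => P.Label ⊕ Q.Label

instance fintypeLabel : (P : StackProg K) → Fintype P.Label
  | emit _ _ => inferInstanceAs (Fintype Unit)
  | move _ _ => inferInstanceAs (Fintype Unit)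
  | loop _ P => by
      have := fintypeLabel P
      exact inferInstanceAs (Fintype (Option P.Label))
  | seq P Q => by
      have := fintypeLabel P
      have := fintypeLabel Q
      exact inferInstanceAs (Fintype (P.Label ⊕ Q.Label))

/-- The label at which the code of a program starts. -/
def entry : (P : StackProg K) → P.Label
  | emit _ _ => ()
  | move _ _ => ()
  | loop _ _ => none
  | seq P _ => Sum.inl P.entry

/-- The statement that pushes a string on a stack and jumps to a label. -/
def pushAll {Λ : Type} (k : K) (e : Λ) : List Bool → TM2.Stmt (fun _ : K => Bool) Λ (Option Bool)
  | [] => .goto fun _ => e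
  | b :: s => .push k (fun _ => b) (pushAll k e s)

/-- The Turing machine code of a program, inside a machine with labels `Λ`: `ι` places the labels
of the program, and `e` is the label to be visited after it. The internal state holds the last
popped symbol. -/
def code {Λ : Type} : (P : StackProg K) → (P.Label → Λ) → Λ → P.Label →
    TM2.Stmt (fun _ : K => Bool) Λ (Option Bool)
  | emit k s, _, e, _ => pushAll k e s.reverse
  | move k k', ι, e, _ =>
      .pop k (fun _ o => o)
        (.branch Option.isSome (.push k' (fun v => v.getD false) (.goto fun _ => ι ()))
          (.goto fun _ => e))
  | loop k P, ι, e, none =>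
      .pop k (fun _ o => o)
        (.branch (fun v => v.getD false) (.goto fun _ => ι (some P.entry)) (.goto fun _ => e))
  | loop _ P, ι, _, some l => P.code (fun l => ι (some l)) (ι none) l
  | seq P Q, ι, _, Sum.inl l => P.code (fun l => ι (Sum.inl l)) (ι (Sum.inr Q.entry)) l
  | seq _ Q, ι, e, Sum.inr l => Q.code (fun l => ι (Sum.inr l)) e l

variable [DecidableEq K]

/-- `P.Runs S t S'`: started on the stacks `S`, the program halts after `t` steps on the stacks
`S'`. -/
inductive Runs : StackProg K → (K → List Bool) → ℕ → (K → List Bool) → Prop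
  | emit (k s S) : Runs (.emit k s) S 1 (Function.update S k (s ++ S k))
  | move_nil {k k' S} (h : S k = []) : Runs (.move k k') S 1 S
  | move_cons {k k' S b r t S'} (h : S k = b :: r)
      (h' : Runs (.move k k') (Function.update (Function.update S k r) k'
        (b :: Function.update S k r k')) t S') : Runs (.move k k') S (t + 1) S'
  | loop_exit {k P S} (h : (S k).head? ≠ some true) :
      Runs (.loop k P) S 1 (Function.update S k (S k).tail)
  | loop_step {k P S r t S' t' S''} (h : S k = true :: r) (hP : Runs P (Function.update S k r) t S')
      (hL : Runs (.loop k P) S' t' S'') : Runs (.loop k P) S (t' + (t + 1)) S''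
  | seq {P Q S t S' t' S''} (hP : Runs P S t S') (hQ : Runs Q S' t' S'') :
      Runs (.seq P Q) S (t' + t) S''

theorem stepAux_pushAll {Λ : Type} (k : K) (e : Λ) (s : List Bool) (v : Option Bool)
    (S : K → List Bool) :
    TM2.stepAux (pushAll k e s) v S = ⟨some e, v, Function.update S k (s.reverse ++ S k)⟩ := by
  induction s generalizing S with
  | nil => simp [pushAll]
  | cons b s ih => simp [pushAll, ih]

/-- A machine containing the code of a program follows the semantics of the program. -/
theorem Runs.iterate_step {P : StackProg K} {S S' : K → List Bool} {t : ℕ} (h : P.Runs S t S') :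
    ∀ {Λ : Type} (M : Λ → TM2.Stmt (fun _ : K => Bool) Λ (Option Bool)) (ι : P.Label → Λ) (e : Λ),
      (∀ l, M (ι l) = P.code ι e l) → ∀ v, ∃ v',
        (flip bind (TM2.step M))^[t] (some ⟨some (ι P.entry), v, S⟩) = some ⟨some e, v', S'⟩ := by
  induction h with
  | emit k s S =>
    intro Λ M ι e hM v
    refine ⟨v, ?_⟩
    simp [flip, TM2.step, hM, code, stepAux_pushAll]
  | @move_nil k k' S h =>
    intro Λ M ι e hM v
    refine ⟨none, ?_⟩
    have : Function.update S k [] = S := by rw [← h]; simp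
    simp [flip, TM2.step, hM, code, h, this]
  | @move_cons k k' S b r t S' h _ ih =>
    intro Λ M ι e hM v
    obtain ⟨v', hv⟩ := ih M ι e hM (some b)
    refine ⟨v', ?_⟩
    have hc : M (ι (entry _)) = .pop k (fun _ o => o)
        (.branch Option.isSome (.push k' (fun v => v.getD false) (.goto fun _ => ι (entry _)))
          (.goto fun _ => e)) := hM _
    rw [Function.iterate_succ_apply, ← hv]
    simp [flip, TM2.step, hc, h]
  | @loop_exit k P S h =>
    intro Λ M ι e hM v
    refine ⟨(S k).head?, ?_⟩
    have : (S k).head?.getD false = false := by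
      cases hd : (S k).head? with
      | none => rfl
      | some b => cases b <;> simp_all
    have hc : M (ι (entry _)) = .pop k (fun _ o => o)
        (.branch (fun v => v.getD false) (.goto fun _ => ι (some P.entry)) (.goto fun _ => e)) :=
      hM _
    simp [flip, TM2.step, hc, this]
  | @loop_step k P S r t S' t' S'' h _ _ ih ih' =>
    intro Λ M ι e hM v
    obtain ⟨v₁, h₁⟩ := ih M (fun l => ι (some l)) (ι none) (fun l => hM (some l)) (some true)
    obtain ⟨v₂, h₂⟩ := ih' M ι e hM v₁
    refine ⟨v₂, ?_⟩
    rw [Function.iterate_add_apply, Function.iterate_succ_apply, ← h₂]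
    have hc : M (ι (entry (.loop k P))) = .pop k (fun _ o => o)
        (.branch (fun v => v.getD false) (.goto fun _ => ι (some P.entry)) (.goto fun _ => e)) :=
      hM _
    have hs : flip bind (TM2.step M) (some ⟨some (ι (entry (.loop k P))), v, S⟩) =
        some ⟨some (ι (some P.entry)), some true, Function.update S k r⟩ := by
      simp [flip, TM2.step, hc, h]
    rw [hs, h₁]
    rfl
  | @seq P Q S t S' t' S'' _ _ ih ih' =>
    intro Λ M ι e hM v
    obtain ⟨v₁, h₁⟩ :=
      ih M (fun l => ι (Sum.inl l)) (ι (Sum.inr Q.entry)) (fun l => hM (Sum.inl l)) v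
    obtain ⟨v₂, h₂⟩ := ih' M (fun l => ι (Sum.inr l)) e (fun l => hM (Sum.inr l)) v₁
    refine ⟨v₂, ?_⟩
    rw [Function.iterate_add_apply, ← h₂, ← h₁]
    rfl

/-- `P.RunsIn S T S'`: started on the stacks `S`, the program halts within `T` steps on the stacks
`S'`. -/
def RunsIn (P : StackProg K) (S : K → List Bool) (T : ℕ) (S' : K → List Bool) : Prop :=
  ∃ t ≤ T, P.Runs S t S'

theorem RunsIn.mono {P : StackProg K} {S S' : K → List Bool} {T T' : ℕ} (h : P.RunsIn S T S')
    (hT : T ≤ T') : P.RunsIn S T' S' := by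
  obtain ⟨t, ht, h⟩ := h
  exact ⟨t, ht.trans hT, h⟩

theorem RunsIn.seq {P Q : StackProg K} {S S' S'' : K → List Bool} {T T' : ℕ} (h : P.RunsIn S T S')
    (h' : Q.RunsIn S' T' S'') : (P.seq Q).RunsIn S (T + T') S'' := by
  obtain ⟨t, ht, h⟩ := h
  obtain ⟨t', ht', h'⟩ := h'
  exact ⟨t' + t, by omega, h.seq h'⟩

theorem RunsIn.emit {k : K} {s : List Bool} {S S' : K → List Bool}
    (h : Function.update S k (s ++ S k) = S') : (StackProg.emit k s).RunsIn S 1 S' :=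
  h ▸ ⟨1, le_rfl, .emit k s S⟩

/-- A loop whose control stack holds `n` times `true` and then possibly `false`: the stacks are
`F j` when `j` passes are still to be made. -/
theorem RunsIn.loop {P : StackProg K} {k : K} {T n : ℕ} {S' : K → List Bool}
    (F : ℕ → K → List Bool)
    (hbody : ∀ j < n, ∃ r, F (j + 1) k = true :: r ∧
      P.RunsIn (Function.update (F (j + 1)) k r) T (F j))
    (hexit : (F 0 k).head? ≠ some true) (hS' : Function.update (F 0) k (F 0 k).tail = S') :
    (StackProg.loop k P).RunsIn (F n) (n * (T + 1) + 1) S' := by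
  subst hS'
  induction n with
  | zero => exact ⟨1, by simp, .loop_exit hexit⟩
  | succ n ih =>
    obtain ⟨t', ht', h'⟩ := ih fun j hj => hbody j (hj.trans n.lt_succ_self)
    obtain ⟨r, hr, t, ht, h⟩ := hbody n n.lt_succ_self
    exact ⟨t' + (t + 1), by linarith [Nat.succ_mul n (T + 1)], .loop_step hr h h'⟩

theorem RunsIn.move {k k' : K} (hk : k ≠ k') {S S' : K → List Bool} {T : ℕ}
    (hT : (S k).length + 1 ≤ T)
    (h : Function.update (Function.update S k []) k' ((S k).reverse ++ S k') = S') :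
    (StackProg.move k k').RunsIn S T S' := by
  subst h
  refine RunsIn.mono ?_ hT
  clear hT
  generalize hl : S k = l
  induction l generalizing S with
  | nil =>
    refine ⟨1, by simp, ?_⟩
    have : Function.update (Function.update S k []) k' ([].reverse ++ S k') = S := by
      have h1 : Function.update S k [] = S := by rw [← hl, Function.update_eq_self]
      simp [h1]
    rw [this]
    exact Runs.move_nil hl
  | cons b r ih =>
    have := ih (S := Function.update (Function.update S k r) k' (b :: Function.update S k r k'))
      (by simp [hk])
    obtain ⟨t, ht, h⟩ := this
    refine ⟨t + 1, by simpa using ht, .move_cons hl ?_⟩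
    convert h using 1
    ext x : 1
    by_cases h1 : x = k' <;> by_cases h2 : x = k <;> simp_all [hk.symm]

/-- The Turing machine executing a program, with input stack `k₀` and output stack `k₁`. -/
def machine [Fintype K] (P : StackProg K) (k₀ k₁ : K) : FinTM2 where
  K := K
  k₀ := k₀
  k₁ := k₁
  Γ := fun _ => Bool
  Λ := Option P.Label
  main := some P.entry
  σ := Option Bool
  initialState := none
  Γk₀Fin := inferInstanceAs (Fintype Bool)
  m
    | none => .load (fun _ => none) .halt
    | some l => P.code some none l

/-- A program that runs in polynomial time and leaves nothing but its result shows that a function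
is computable in polynomial time. -/
theorem polyTime_of_runsIn [Fintype K] {α : Type} {ea : α → List Bool} {β : Type}
    {eb : β → List Bool} {f : α → β} (P : StackProg K) (k₀ k₁ : K) (N : Polynomial ℕ)
    (h : ∀ a, P.RunsIn (Function.update (fun _ => []) k₀ (ea a)) (N.eval (ea a).length)
      (Function.update (fun _ => []) k₁ (eb (f a)))) :
    Nonempty (TM2ComputableInPolyTime ea eb f) := by
  refine ⟨{ tm := P.machine k₀ k₁
            inputAlphabet := Equiv.refl Bool
            outputAlphabet := Equiv.refl Bool
            time := N + 1
            outputsFun := fun a => ?_ }⟩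
  have hrun : ∀ x y : List Bool, x = ea a → y = eb (f a) → ∃ t ≤ (N + 1).eval (ea a).length,
      (flip bind (P.machine k₀ k₁).step)^[t] (some (initList (P.machine k₀ k₁) x)) =
        some (haltList (P.machine k₀ k₁) y) := by
    rintro _ _ rfl rfl
    obtain ⟨t, ht, hr⟩ := h a
    obtain ⟨v', hv⟩ := hr.iterate_step (P.machine k₀ k₁).m some none (fun l => rfl) none
    refine ⟨1 + t, by simp; omega, ?_⟩
    have h0 : initList (P.machine k₀ k₁) (ea a) = ⟨some (some P.entry), none,
        Function.update (fun _ => []) k₀ (ea a)⟩ := by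
      unfold initList
      congr 1
      funext k
      change K at k
      by_cases hk : k = k₀
      · cases hk
        exact (dif_pos rfl).trans
          (Function.update_self (β := fun _ : K => List Bool) k₀ (ea a) _).symm
      · exact (dif_neg hk).trans
          (Function.update_of_ne (β := fun _ : K => List Bool) hk (ea a) fun _ => []).symm
    have h1 : haltList (P.machine k₀ k₁) (eb (f a)) = ⟨none, none,
        Function.update (fun _ => []) k₁ (eb (f a))⟩ := by
      unfold haltList
      congr 1
      funext k
      change K at k
      by_cases hk : k = k₁
      · cases hk
        exact (dif_pos rfl).trans
          (Function.update_self (β := fun _ : K => List Bool) k₁ (eb (f a)) _).symm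
      · exact (dif_neg hk).trans
          (Function.update_of_ne (β := fun _ : K => List Bool) hk (eb (f a)) fun _ => []).symm
    rw [Function.iterate_add_apply, h0, h1]
    erw [hv]
    rfl
  have hrun' := hrun _ _ (List.map_id (ea a)) (List.map_id (eb (f a)))
  have hle : hrun'.choose ≤ (N + 1).eval (ea a).length := hrun'.choose_spec.1
  exact ⟨⟨hrun'.choose, hrun'.choose_spec.2⟩, by simpa using hle⟩

end StackProg

/-- Constant functions are computable in polynomial time. -/
theorem polyTimeNat_const (c : ℕ) : PolyTimeNat fun _ => c := by
  refine StackProg.polyTime_of_runsIn (K := Bool)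
    (.seq (.loop false (.emit false [])) (.emit true (Computability.encodeNat c))) false true
    (2 * Polynomial.X + 2) fun t => ?_
  have hlen : ∀ t, Computability.unaryEncodeNat t = List.replicate t true := by
    intro t
    induction t with
    | zero => rfl
    | succ t ih => simp [Computability.unaryEncodeNat, ih, List.replicate_succ]
  rw [hlen]
  refine StackProg.RunsIn.mono (StackProg.RunsIn.seq
    (StackProg.RunsIn.loop (T := 1) (n := t)
      (fun j => Function.update (fun _ => []) false (List.replicate j true))
      (fun j _ => ⟨List.replicate j true, by simp [List.replicate_succ], ?_⟩) (by simp) rfl)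
    (StackProg.RunsIn.emit ?_)) ?_
  · exact .emit (by simp)
  · ext k : 1
    cases k <;> simp
  · simp
    omega

end StackPrograms

section GatesAndCircuits

open Matrix
open scoped Kronecker ComplexOrder

/-! ### Operations in Kraus form -/

section Kraus

variable {I J E : Type} [Fintype I] [Fintype E]

/-- The operation `X ↦ ∑ₑ Kₑ X Kₑ†`. -/
noncomputable def kraus (K : E → Matrix J I ℂ) : Transf I J where
  toFun X := ∑ e, K e * X * (K e)ᴴ
  map_add' X Y := by simp [Matrix.mul_add, Matrix.add_mul, Finset.sum_add_distrib]
  map_smul' r X := by simp [Finset.smul_sum]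

theorem kraus_apply (K : E → Matrix J I ℂ) (X : Op I) : kraus K X = ∑ e, K e * X * (K e)ᴴ := rfl

theorem kraus_apply_apply (K : E → Matrix J I ℂ) (X : Op I) (j j' : J) :
    kraus K X j j' = ∑ e, ∑ i', ∑ i, K e j i * X i i' * star (K e j' i') := by
  simp [kraus_apply, Matrix.sum_apply, Matrix.mul_apply, Finset.sum_mul]

theorem ampR_kraus (R : Type) [Fintype R] [DecidableEq R] (K : E → Matrix J I ℂ) :
    ampR R (kraus K) = kraus fun e => K e ⊗ₖ (1 : Matrix R R ℂ) := by
  ext X x y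
  change kraus K (Matrix.of fun i i' => X (i, x.2) (i', y.2)) x.1 y.1 = _
  simp only [kraus_apply_apply, Matrix.kroneckerMap_apply, Fintype.sum_prod_type, Matrix.one_apply,
    Matrix.of_apply]
  refine Finset.sum_congr rfl fun e _ => Finset.sum_congr rfl fun i' _ => ?_
  rw [Finset.sum_eq_single y.2 (fun b _ hb => by simp [hb.symm]) (by simp)]
  refine Finset.sum_congr rfl fun i _ => ?_
  rw [Finset.sum_eq_single x.2 (fun b _ hb => by simp [hb.symm]) (by simp)]
  simp

theorem isDensity_kraus [Fintype J] [DecidableEq I] {K : E → Matrix J I ℂ}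
    (hK : ∑ e, (K e)ᴴ * K e = 1) {ρ : Op I} (hρ : IsDensity ρ) : IsDensity (kraus K ρ) := by
  refine ⟨?_, ?_⟩
  · exact Matrix.posSemidef_sum _ fun e _ => hρ.1.mul_mul_conjTranspose_same (K e)
  · rw [kraus_apply, Matrix.trace_sum]
    simp_rw [fun e => Matrix.trace_mul_comm (K e * ρ) (K e)ᴴ, ← Matrix.mul_assoc]
    rw [← Matrix.trace_sum, ← Finset.sum_mul, hK, one_mul, hρ.2]

theorem isAdmissible_kraus [Fintype J] [DecidableEq I] {K : E → Matrix J I ℂ}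
    (hK : ∑ e, (K e)ᴴ * K e = 1) : IsAdmissible (kraus K) := by
  intro m ρ hρ
  rw [ampR_kraus]
  refine isDensity_kraus ?_ hρ
  simp_rw [Matrix.conjTranspose_kronecker, ← Matrix.mul_kronecker_mul, Matrix.conjTranspose_one,
    one_mul]
  rw [← Matrix.one_kronecker_one, ← hK]
  ext x y
  simp [Matrix.sum_apply, Matrix.kroneckerMap_apply, Finset.sum_mul]

end Kraus

/-! ### Gates acting on basis states -/

section FunGate

variable {I J E : Type} [Fintype I] [Fintype E] [DecidableEq J] [DecidableEq E]

/-- The operation that maps the basis state `i` to the basis state `f i` of a system `J × E` and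
then discards the part `E`. -/
noncomputable def funOp (f : I → J × E) : Transf I J :=
  kraus fun e => Matrix.of fun j i => if f i = (j, e) then 1 else 0

theorem isAdmissible_funOp [Fintype J] [DecidableEq I] {f : I → J × E}
    (hf : Function.Injective f) : IsAdmissible (funOp f) := by
  refine isAdmissible_kraus ?_
  ext i i'
  simp only [Matrix.sum_apply, Matrix.mul_apply, Matrix.conjTranspose_apply, Matrix.of_apply,
    Matrix.one_apply]
  rw [Finset.sum_comm]
  rw [← Fintype.sum_prod_type' (f := fun j e => star (if f i = (j, e) then (1 : ℂ) else 0) *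
    if f i' = (j, e) then 1 else 0)]
  simp [hf.eq_iff, eq_comm]

theorem funOp_apply_apply (f : I → J × E) (X : Op I) (j j' : J) :
    funOp f X j j' =
      ∑ e, ∑ i', ∑ i, if f i = (j, e) ∧ f i' = (j', e) then X i i' else 0 := by
  simp only [funOp, kraus_apply_apply, Matrix.of_apply]
  refine Finset.sum_congr rfl fun e _ => Finset.sum_congr rfl fun i' _ =>
    Finset.sum_congr rfl fun i _ => ?_
  by_cases h : f i = (j, e) <;> by_cases h' : f i' = (j', e) <;> simp [h, h']

theorem funOp_single [DecidableEq I] (f : I → J × E) (i i' : I) (j j' : J) :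
    funOp f (Matrix.single i i' 1) j j' =
      if (f i).1 = j ∧ (f i').1 = j' ∧ (f i).2 = (f i').2 then 1 else 0 := by
  rw [funOp_apply_apply, Finset.sum_eq_single (f i).2, Finset.sum_eq_single i',
    Finset.sum_eq_single i]
  · simp [Prod.ext_iff, eq_comm]
  · intro b _ hb
    simp [hb.symm]
  · simp
  · intro b _ hb
    simp [hb.symm]
  · simp
  · intro e _ he
    refine Finset.sum_eq_zero fun b _ => Finset.sum_eq_zero fun b' _ => ?_
    by_cases h : f b' = (j, e)
    · rw [Matrix.single_apply, if_neg (c := i = b' ∧ i' = b), ite_self]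
      rintro ⟨rfl, rfl⟩
      exact he (by rw [h])
    · simp [h]
  · simp

end FunGate

/-- A quantum gate together with its type. -/
structure Gate where
  inputs : ℕ
  outputs : ℕ
  op : Transf (Bits inputs) (Bits outputs)
  admissible : IsAdmissible op

/-- The matrix of a gate consists of efficiently approximable numbers. -/
def Gate.Reasonable (Γ : Gate) : Prop :=
  ∀ (i i' : Bits Γ.inputs) (j j' : Bits Γ.outputs), EffApprox (Γ.op (Matrix.single i i' 1) j j')

theorem effApproxReal_natCast_div (p q : ℕ) (hq : 0 < q) : EffApproxReal ((p : ℝ) / q) :=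
  ⟨_, _, _, polyTimeNat_const p, polyTimeNat_const 0, polyTimeNat_const q, fun t => ⟨hq, by simp⟩⟩

theorem effApprox_ofReal {x : ℝ} (hx : EffApproxReal x) : EffApprox (x : ℂ) := by
  refine ⟨by simpa using hx, ?_⟩
  simpa using effApproxReal_natCast_div 0 1 one_pos

theorem effApprox_zero : EffApprox 0 := by
  simpa using effApprox_ofReal (effApproxReal_natCast_div 0 1 one_pos)

theorem effApprox_one : EffApprox 1 := by
  simpa using effApprox_ofReal (effApproxReal_natCast_div 1 1 one_pos)

theorem effApprox_half : EffApprox (1 / 2) := by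
  simpa using effApprox_ofReal (effApproxReal_natCast_div 1 2 two_pos)

/-- The gate that creates a uniformly random classical bit. Its Kraus operators are `|e⟩ / √2`, but
its matrix has the entries `1/2` and `0` only, so it is efficiently approximable. -/
noncomputable abbrev coinGate : Gate where
  inputs := 0
  outputs := 1
  op := kraus fun e : Bool => Matrix.of fun j _ => if j 0 = e then (((√2)⁻¹ : ℝ) : ℂ) else 0
  admissible := by
    refine isAdmissible_kraus ?_
    ext i i'
    have h : ((√2 : ℝ) : ℂ) * ((√2 : ℝ) : ℂ) = 2 := by
      rw [← Complex.ofReal_mul, Real.mul_self_sqrt (by norm_num)]; norm_num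
    have hi : i = i' := Subsingleton.elim _ _
    subst hi
    rw [Matrix.one_apply_eq]
    simp only [Matrix.sum_apply, Matrix.mul_apply, Matrix.conjTranspose_apply, Matrix.of_apply]
    rw [Fintype.sum_bool, ← (Equiv.funUnique (Fin 1) Bool).symm.sum_comp,
      ← (Equiv.funUnique (Fin 1) Bool).symm.sum_comp]
    simp only [Fintype.sum_bool, Equiv.funUnique]
    simp [← mul_inv, h]
    norm_num

theorem coinGate_op_apply (X : Op (Bits 0)) (j j' : Bits 1) :
    coinGate.op X j j' = if j = j' then X ![] ![] / 2 else 0 := by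
  have h : ((√2 : ℝ) : ℂ) * ((√2 : ℝ) : ℂ) = 2 := by
    rw [← Complex.ofReal_mul, Real.mul_self_sqrt (by norm_num)]; norm_num
  have hj : j = j' ↔ j 0 = j' 0 := by
    constructor
    · rintro rfl; rfl
    · intro h; ext i; rw [Subsingleton.elim i 0, h]
  obtain ⟨z, hz⟩ : ∃ z, ∀ x y, X x y = z :=
    ⟨X ![] ![], fun x y => by rw [Subsingleton.elim x ![], Subsingleton.elim y ![]]⟩
  rw [kraus_apply_apply]
  simp only [hj, hz, Matrix.of_apply, Fintype.sum_unique, Fintype.sum_bool]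
  cases j 0 <;> cases j' 0 <;> simp
  all_goals
    rw [div_eq_mul_inv, ← h, mul_inv]
    ring

/-- The gate that routes a qubit `x`, followed by a classical bit `c`, to one of two places, the
other one being filled with `0`: `(x, c) ↦ (c, x, 0)` if `c = 0` and `(x, c) ↦ (c, 0, x)` if
`c = 1`. -/
noncomputable abbrev routeGate : Gate where
  inputs := 2
  outputs := 3
  op := funOp fun b : Bits 2 =>
    ((![b 1, !b 1 && b 0, b 1 && b 0] : Bits 3), (![] : Bits 0))
  admissible := isAdmissible_funOp (by decide)

/-- The gate that selects one of two qubits according to a classical bit `c` and discards the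
other one: `(c, x, y) ↦ (x, c)` if `c = 0` and `(c, x, y) ↦ (y, c)` if `c = 1`. A copy of `c` is
discarded too, without which the map of basis states would not be injective. -/
noncomputable abbrev selectGate : Gate where
  inputs := 3
  outputs := 2
  op := funOp fun b : Bits 3 =>
    ((![bif b 0 then b 2 else b 1, b 0] : Bits 2),
      (![bif b 0 then b 1 else b 2, b 0] : Bits 2))
  admissible := isAdmissible_funOp (by decide)

theorem tasteDecision_comp_rename :
    tasteDecision ∘ₗ rename (splitBits 1 1) =
      funOp fun b : Bits 2 => ((fun _ => b 0 == b 1 : Bits 1), b) := by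
  ext X j j'
  have hj : j = j' ↔ j 0 = j' 0 := by
    constructor
    · rintro rfl; rfl
    · intro h; ext i; rw [Subsingleton.elim i 0, h]
  have hf : ∀ (b : Bool) (j : Bits 1), (fun _ => b) = j ↔ b = j 0 := by
    intro b j
    constructor
    · rintro rfl; rfl
    · rintro rfl; ext i; rw [Subsingleton.elim i 0]
  have hs : ∀ a b : Bool, (splitBits 1 1).symm (fun _ => a, fun _ => b) = ![a, b] := by
    intro a b
    ext i
    fin_cases i <;> rfl
  have h1 : funOp (fun b : Bits 2 => ((fun _ => b 0 == b 1 : Bits 1), b)) X j j' =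
      ∑ b : Bits 2, if (b 0 == b 1) = j 0 ∧ (b 0 == b 1) = j' 0 then X b b else 0 := by
    rw [funOp_apply_apply]
    refine Finset.sum_congr rfl fun e _ => ?_
    rw [Finset.sum_eq_single e (fun b _ hb => by simp [hb]) (by simp),
      Finset.sum_eq_single e (fun b _ hb => by simp [hb]) (by simp)]
    simp [hf]
  rw [h1, ← finTwoArrowEquiv Bool |>.symm.sum_comp, Fintype.sum_prod_type]
  change Matrix.diagonal (fun out : Bits 1 => ∑ i : Bool, ∑ j : Bool, if (i == j) = out 0 then
    X ((splitBits 1 1).symm (fun _ => i, fun _ => j))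
      ((splitBits 1 1).symm (fun _ => i, fun _ => j)) else 0) j j' = _
  simp only [Matrix.diagonal_apply, hj, hs, finTwoArrowEquiv]
  by_cases h : j 0 = j' 0
  · simp [h]
  · rw [if_neg h]
    symm
    refine Finset.sum_eq_zero fun a _ => Finset.sum_eq_zero fun b _ => if_neg ?_
    rintro ⟨h1, h2⟩
    exact h (h1.symm.trans h2)

/-- The gate that compares two bits, in the standard basis. -/
noncomputable abbrev compareGate : Gate where
  inputs := 2
  outputs := 1
  op := tasteDecision ∘ₗ rename (splitBits 1 1)
  admissible := by
    rw [tasteDecision_comp_rename]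
    exact isAdmissible_funOp fun b b' h => (Prod.ext_iff.mp h).2

theorem coinGate_reasonable : coinGate.Reasonable := by
  intro i i' j j'
  rw [coinGate_op_apply, Subsingleton.elim i ![], Subsingleton.elim i' ![],
    Matrix.single_apply_same]
  split_ifs
  · exact effApprox_half
  · exact effApprox_zero

theorem effApprox_funOp {I J E : Type} [Fintype I] [DecidableEq I] [Fintype E] [DecidableEq J]
    [DecidableEq E] (f : I → J × E) (i i' : I) (j j' : J) :
    EffApprox (funOp f (Matrix.single i i' 1) j j') := by
  rw [funOp_single]
  split_ifs
  · exact effApprox_one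
  · exact effApprox_zero

theorem routeGate_reasonable : routeGate.Reasonable := fun _ _ _ _ => effApprox_funOp _ _ _ _ _

theorem selectGate_reasonable : selectGate.Reasonable := fun _ _ _ _ => effApprox_funOp _ _ _ _ _

theorem compareGate_reasonable : compareGate.Reasonable := by
  intro i i' j j'
  change EffApprox ((tasteDecision ∘ₗ rename (splitBits 1 1)) _ j j')
  rw [tasteDecision_comp_rename]
  exact effApprox_funOp _ _ _ _ _

/-! ### The gate set of the blind taste-test -/

section GateSet

variable (G : GateSet)

/-- The gates of `G`, followed by the four gates of the blind taste-test. -/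
noncomputable def tasteGates : Fin (G.size + 4) → Gate :=
  Fin.append (fun g => ⟨G.inputs g, G.outputs g, G.op g, G.admissible g⟩)
    ![coinGate, routeGate, selectGate, compareGate]

/-- The gate set `G`, extended by the four gates of the blind taste-test. -/
noncomputable def tasteGateSet : GateSet where
  size := G.size + 4
  inputs g := (tasteGates G g).inputs
  outputs g := (tasteGates G g).outputs
  op g := (tasteGates G g).op
  admissible g := (tasteGates G g).admissible

theorem tasteGateSet_reasonable (hG : G.Reasonable) : (tasteGateSet G).Reasonable := by
  suffices h : ∀ g, (tasteGates G g).Reasonable from h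
  intro g
  refine Fin.addCases (fun g => ?_) (fun g => ?_) g
  · rw [tasteGates, Fin.append_left]
    exact hG g
  · rw [tasteGates, Fin.append_right]
    fin_cases g
    · exact coinGate_reasonable
    · exact routeGate_reasonable
    · exact selectGate_reasonable
    · exact compareGate_reasonable

variable {G}

/-- The circuit over the extended gate set that consists of a single gate `Γ`, found at the
index `g`. The equation `h` adjusts the type of the circuit. -/
noncomputable def gateCircuit (g : Fin (G.size + 4)) {Γ : Gate} (h : tasteGates G g = Γ) :
    Circuit (tasteGateSet G) Γ.inputs Γ.outputs :=
  h ▸ (Circuit.gate (G := tasteGateSet G) g)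

theorem gateCircuit_op (g : Fin (G.size + 4)) {Γ : Gate} (h : tasteGates G g = Γ) :
    (gateCircuit g h).op = Γ.op := by
  subst h; rfl

theorem gateCircuit_encode (g : Fin (G.size + 4)) {Γ : Gate} (h : tasteGates G g = Γ) :
    (gateCircuit g h).encode = [false, false] ++ unary g := by
  subst h; rfl

/-- A circuit over `G` as a circuit over the extended gate set. -/
noncomputable def liftCircuit : {n m : ℕ} → Circuit G n m → Circuit (tasteGateSet G) n m
  | _, _, .gate g => gateCircuit (Fin.castAdd 4 g) (Fin.append_left _ _ g)
  | _, _, .wires n => .wires n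
  | _, _, .cross a b => .cross a b
  | _, _, .seq c d => .seq (liftCircuit c) (liftCircuit d)
  | _, _, .par c d => .par (liftCircuit c) (liftCircuit d)

theorem liftCircuit_op {n m : ℕ} (c : Circuit G n m) : (liftCircuit c).op = c.op := by
  induction c with
  | gate g => exact gateCircuit_op _ _
  | wires n => rfl
  | cross a b => rfl
  | seq c d ihc ihd => simp only [liftCircuit, Circuit.op, ihc, ihd]
  | par c d ihc ihd => simp only [liftCircuit, Circuit.op, ihc, ihd]

/-- The description of a circuit does not change when the gate set is extended. -/
theorem liftCircuit_encode {n m : ℕ} (c : Circuit G n m) :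
    (liftCircuit c).encode = c.encode := by
  induction c with
  | gate g => exact gateCircuit_encode _ _
  | wires n => rfl
  | cross a b => rfl
  | seq c d ihc ihd => simp only [liftCircuit, Circuit.encode, ihc, ihd]
  | par c d ihc ihd => simp only [liftCircuit, Circuit.encode, ihc, ihd]

/-- A circuit with its type rewritten along equations. -/
def castCircuit {G : GateSet} {n m n' m' : ℕ} (hn : n = n') (hm : m = m') (c : Circuit G n m) :
    Circuit G n' m' :=
  hn ▸ hm ▸ c

theorem castCircuit_encode {G : GateSet} {n m n' m' : ℕ} (hn : n = n') (hm : m = m')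
    (c : Circuit G n m) : (castCircuit hn hm c).encode = c.encode := by
  subst hn hm; rfl

end GateSet

/-! ### Trace-preserving and Hermiticity-preserving transformations -/

theorem conjTranspose_ampR {I J K : Type} {Φ : Transf I J} (hΦ : ∀ X, Φ Xᴴ = (Φ X)ᴴ)
    (X : Op (I × K)) :
    ampR K Φ Xᴴ = (ampR K Φ X)ᴴ := by
  ext x y
  exact congrFun (congrFun (hΦ (Matrix.of fun i i' => X (i, y.2) (i', x.2))) x.1) y.1

theorem conjTranspose_ampL {I J K : Type} {Φ : Transf I J} (hΦ : ∀ X, Φ Xᴴ = (Φ X)ᴴ)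
    (X : Op (K × I)) :
    ampL K Φ Xᴴ = (ampL K Φ X)ᴴ := by
  ext x y
  exact congrFun (congrFun (hΦ (Matrix.of fun i i' => X (y.1, i) (x.1, i'))) x.2) y.2

section Preserving

variable {I J K : Type} [Fintype I] [Fintype J] [Fintype K]

/-- Transformations that preserve traces and adjoints. -/
structure PreservesTraceStar (Φ : Transf I J) : Prop where
  trace : ∀ X, (Φ X).trace = X.trace
  conjTranspose : ∀ X, Φ Xᴴ = (Φ X)ᴴ

/-- An admissible operation with no further qubits present maps states to states. -/
theorem _root_.QIPDefs.IsAdmissible.isDensity {Φ : Transf I J} (hΦ : IsAdmissible Φ) {ρ : Op I}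
    (hρ : IsDensity ρ) : IsDensity (Φ ρ) := by
  have h := hΦ 0 (ρ.submatrix Prod.fst Prod.fst) ⟨hρ.1.submatrix _, by
    rw [← hρ.2]
    simp [Matrix.trace, Fintype.sum_prod_type]⟩
  refine ⟨h.1.submatrix fun j => (j, ![]), ?_⟩
  rw [← h.2]
  simp only [Matrix.trace, Matrix.diag, Fintype.sum_prod_type, Fintype.sum_unique]
  rfl

theorem _root_.QIPDefs.IsAdmissible.trace_of_posSemidef {Φ : Transf I J} (hΦ : IsAdmissible Φ)
    {X : Op I} (hX : X.PosSemidef) : (Φ X).PosSemidef ∧ (Φ X).trace = X.trace := by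
  by_cases h0 : X.trace = 0
  · rw [hX.trace_eq_zero_iff.mp h0]
    simp [Matrix.PosSemidef.zero]
  · have hd : IsDensity (X.trace⁻¹ • X) := by
      refine ⟨hX.smul (inv_nonneg.mpr hX.trace_nonneg), ?_⟩
      rw [Matrix.trace_smul, smul_eq_mul, inv_mul_cancel₀ h0]
    have h := hΦ.isDensity hd
    have hX' : Φ X = X.trace • Φ (X.trace⁻¹ • X) := by
      rw [map_smul, smul_smul, mul_inv_cancel₀ h0, one_smul]
    rw [hX']
    refine ⟨h.1.smul hX.trace_nonneg, ?_⟩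
    rw [Matrix.trace_smul, h.2, smul_eq_mul, mul_one]

theorem _root_.QIPDefs.IsAdmissible.of_isHermitian {Φ : Transf I J} (hΦ : IsAdmissible Φ) {X : Op I}
    (hX : X.IsHermitian) : (Φ X).IsHermitian ∧ (Φ X).trace = X.trace := by
  classical
  -- a Hermitian operator is a difference of squares of Hermitian operators
  have h : X = (4⁻¹ : ℂ) • ((X + 1)ᴴ * (X + 1) - (X - 1)ᴴ * (X - 1)) := by
    rw [Matrix.conjTranspose_add, Matrix.conjTranspose_sub, hX.eq, Matrix.conjTranspose_one]
    have : (X + 1) * (X + 1) - (X - 1) * (X - 1) = (4 : ℂ) • X := by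
      rw [show (4 : ℂ) • X = X + X + X + X by module]
      noncomm_ring
    rw [this, smul_smul, inv_mul_cancel₀ (by norm_num), one_smul]
  have h1 := hΦ.trace_of_posSemidef (Matrix.posSemidef_conjTranspose_mul_self (X + 1))
  have h2 := hΦ.trace_of_posSemidef (Matrix.posSemidef_conjTranspose_mul_self (X - 1))
  constructor
  · rw [h, map_smul, map_sub]
    refine (h1.1.isHermitian.sub h2.1.isHermitian).smul ?_
    simp [isSelfAdjoint_iff]
  · conv_rhs => rw [h]
    conv_lhs => rw [h]
    simp only [map_smul, map_sub, Matrix.trace_smul, Matrix.trace_sub, h1.2, h2.2]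

theorem _root_.QIPDefs.IsAdmissible.preservesTraceStar {Φ : Transf I J} (hΦ : IsAdmissible Φ) :
    PreservesTraceStar Φ := by
  have key : ∀ X : Op I, ∃ A B : Op I, A.IsHermitian ∧ B.IsHermitian ∧ X = A + Complex.I • B := by
    intro X
    refine ⟨(2⁻¹ : ℂ) • (X + Xᴴ), (-(2⁻¹ : ℂ) * Complex.I) • (X - Xᴴ), ?_, ?_, ?_⟩
    · simp [Matrix.IsHermitian, add_comm]
    · simp only [Matrix.IsHermitian, Matrix.conjTranspose_smul, Matrix.conjTranspose_sub,
        Matrix.conjTranspose_conjTranspose]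
      simp
      module
    · rw [smul_smul, show Complex.I * (-2⁻¹ * Complex.I) = 2⁻¹ by
        linear_combination (-2⁻¹ : ℂ) * Complex.I_mul_I]
      module
  refine ⟨fun X => ?_, fun X => ?_⟩
  · obtain ⟨A, B, hA, hB, rfl⟩ := key X
    simp only [map_add, map_smul, Matrix.trace_add, Matrix.trace_smul, (hΦ.of_isHermitian hA).2,
      (hΦ.of_isHermitian hB).2]
  · obtain ⟨A, B, hA, hB, rfl⟩ := key X
    simp only [map_add, map_smul, Matrix.conjTranspose_add, Matrix.conjTranspose_smul, hA.eq, hB.eq,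
      (hΦ.of_isHermitian hA).1.eq, (hΦ.of_isHermitian hB).1.eq]

theorem PreservesTraceStar.comp {Φ : Transf J K} {Ψ : Transf I J} (hΦ : PreservesTraceStar Φ)
    (hΨ : PreservesTraceStar Ψ) : PreservesTraceStar (Φ ∘ₗ Ψ) :=
  ⟨fun X => by simp [hΦ.trace, hΨ.trace], fun X => by simp [hΦ.conjTranspose, hΨ.conjTranspose]⟩

theorem trace_ampR {Φ : Transf I J} (hΦ : ∀ X, (Φ X).trace = X.trace) (X : Op (I × K)) :
    (ampR K Φ X).trace = X.trace := by
  have h : ∀ k, ∑ j, Φ (Matrix.of fun i i' => X (i, k) (i', k)) j j = ∑ i, X (i, k) (i, k) :=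
    fun k => hΦ _
  simp only [Matrix.trace, Matrix.diag, Fintype.sum_prod_type]
  rw [Finset.sum_comm, Finset.sum_comm (f := fun i k => X (i, k) (i, k))]
  exact Finset.sum_congr rfl fun k _ => h k

theorem trace_ampL {Φ : Transf I J} (hΦ : ∀ X, (Φ X).trace = X.trace) (X : Op (K × I)) :
    (ampL K Φ X).trace = X.trace := by
  have h : ∀ k, ∑ j, Φ (Matrix.of fun i i' => X (k, i) (k, i')) j j = ∑ i, X (k, i) (k, i) :=
    fun k => hΦ _
  simp only [Matrix.trace, Matrix.diag, Fintype.sum_prod_type]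
  exact Finset.sum_congr rfl fun k _ => h k

theorem preservesTraceStar_rename (e : I ≃ J) : PreservesTraceStar (rename e) :=
  ⟨fun X => Equiv.sum_comp e.symm fun i => X i i, fun _ => rfl⟩

theorem PreservesTraceStar.tensor {I' J' : Type} [Fintype I'] [Fintype J'] {Φ : Transf I J}
    {Ψ : Transf I' J'} (hΦ : PreservesTraceStar Φ) (hΨ : PreservesTraceStar Ψ) :
    PreservesTraceStar (tensor Φ Ψ) :=
  PreservesTraceStar.comp ⟨trace_ampR hΦ.trace, conjTranspose_ampR hΦ.conjTranspose⟩
    ⟨trace_ampL hΨ.trace, conjTranspose_ampL hΨ.conjTranspose⟩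

theorem preservesTraceStar_circuit {G : GateSet} {n m : ℕ} (c : Circuit G n m) :
    PreservesTraceStar c.op := by
  induction c with
  | gate g => exact IsAdmissible.preservesTraceStar (G.admissible g)
  | wires n => exact ⟨fun _ => rfl, fun _ => rfl⟩
  | cross a b => exact preservesTraceStar_rename _
  | seq c d ihc ihd => exact ihd.comp ihc
  | par c d ihc ihd =>
    exact (preservesTraceStar_rename _).comp ((ihc.tensor ihd).comp (preservesTraceStar_rename _))

end Preserving

/-! ### Product operators -/

/-- The product of operators on two registers, as an operator on the joint register. -/
noncomputable def cat {a b : ℕ} (X : Op (Bits a)) (Y : Op (Bits b)) : Op (Bits (a + b)) :=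
  rename (splitBits a b).symm (X ⊗ₖ Y)

theorem cat_apply {a b : ℕ} (X : Op (Bits a)) (Y : Op (Bits b)) (x y : Bits (a + b)) :
    cat X Y x y = X (splitBits a b x).1 (splitBits a b y).1 *
      Y (splitBits a b x).2 (splitBits a b y).2 := rfl

/-- `cat`, as a bilinear map. -/
noncomputable def catBilin (a b : ℕ) : Op (Bits a) →ₗ[ℂ] Op (Bits b) →ₗ[ℂ] Op (Bits (a + b)) :=
  LinearMap.mk₂ ℂ cat
    (fun X X' Y => by ext; simp [cat_apply, add_mul])
    (fun r X Y => by ext; simp [cat_apply, mul_assoc])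
    (fun X Y Y' => by ext; simp [cat_apply, mul_add])
    (fun r X Y => by ext; simp [cat_apply, mul_left_comm])

theorem catBilin_apply {a b : ℕ} (X : Op (Bits a)) (Y : Op (Bits b)) :
    catBilin a b X Y = cat X Y := rfl

theorem tensor_kronecker {I J I' J' : Type} (Φ : Transf I J) (Ψ : Transf I' J') (X : Op I)
    (Y : Op I') : tensor Φ Ψ (X ⊗ₖ Y) = Φ X ⊗ₖ Ψ Y := by
  have h1 : ∀ x y : I × J', ampL I Ψ (X ⊗ₖ Y) x y = X x.1 y.1 * Ψ Y x.2 y.2 := by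
    intro x y
    change Ψ (X x.1 y.1 • Y) x.2 y.2 = _
    rw [map_smul]
    rfl
  ext x y
  change Φ (Matrix.of fun i i' => ampL I Ψ (X ⊗ₖ Y) (i, x.2) (i', y.2)) x.1 y.1 = _
  have h2 : (Matrix.of fun i i' => ampL I Ψ (X ⊗ₖ Y) (i, x.2) (i', y.2)) =
      Ψ Y x.2 y.2 • X := by
    ext i i'
    simp [h1, mul_comm]
  rw [h2, map_smul]
  exact mul_comm _ _

theorem op_par_cat {G : GateSet} {n m n' m' : ℕ} (c : Circuit G n m) (d : Circuit G n' m')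
    (X : Op (Bits n)) (Y : Op (Bits n')) :
    (Circuit.par c d).op (cat X Y) = cat (c.op X) (d.op Y) := by
  change rename (splitBits m m').symm (tensor c.op d.op
    (rename (splitBits n n') (rename (splitBits n n').symm (X ⊗ₖ Y)))) = _
  have : rename (splitBits n n') (rename (splitBits n n').symm (X ⊗ₖ Y)) = X ⊗ₖ Y := by
    ext x y
    change (X ⊗ₖ Y) (splitBits n n' ((splitBits n n').symm x))
      (splitBits n n' ((splitBits n n').symm y)) = _
    simp
  rw [this, tensor_kronecker]
  rfl

theorem op_cross_cat {G : GateSet} {a b : ℕ} (X : Op (Bits a)) (Y : Op (Bits b)) :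
    (Circuit.cross a b : Circuit G _ _).op (cat X Y) = cat Y X := by
  ext x y
  rw [cat_apply, mul_comm]
  change cat X Y ((splitBits a b).symm (splitBits b a x).swap)
    ((splitBits a b).symm (splitBits b a y).swap) = _
  rw [cat_apply]
  simp

/-! ### Circuits acting on matrix units -/

/-- The matrix unit `|u⟩⟨v|`, for two strings that should have the length `n`. -/
noncomputable def matrixUnit (n : ℕ) (u v : List Bool) : Op (Bits n) :=
  Matrix.single (fun i => u.getD i false) (fun i => v.getD i false) 1

theorem single_eq_matrixUnit {n : ℕ} (x y : Bits n) :
    Matrix.single x y 1 = matrixUnit n (List.ofFn x) (List.ofFn y) := by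
  simp [matrixUnit, List.getD_eq_getElem?_getD]

theorem splitBits_getD {a b : ℕ} (u u' : List Bool) (h : u.length = a) :
    splitBits a b (fun i => (u ++ u').getD i false) =
      ((fun i => u.getD i false : Bits a), (fun i => u'.getD i false : Bits b)) := by
  subst h
  refine (Equiv.symm_apply_eq _).mpr ?_
  ext i
  change _ = Fin.append _ _ i
  refine Fin.addCases (fun i => ?_) (fun i => ?_) i
  · rw [Fin.append_left]
    exact List.getD_append _ _ _ _ i.2
  · rw [Fin.append_right, List.getD_append_right _ _ _ _ (by simp)]
    simp

theorem cat_matrixUnit {a b : ℕ} {u v u' v' : List Bool} (hu : u.length = a) (hv : v.length = a) :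
    cat (matrixUnit a u v) (matrixUnit b u' v') = matrixUnit (a + b) (u ++ u') (v ++ v') := by
  ext x y
  have h : ∀ (w w' : List Bool) (z : Bits (a + b)), w.length = a →
      ((fun i : Fin (a + b) => (w ++ w').getD i false) = z ↔
        (fun i : Fin a => w.getD i false) = (splitBits a b z).1 ∧
        (fun i : Fin b => w'.getD i false) = (splitBits a b z).2) := by
    intro w w' z hw
    rw [← (splitBits a b).apply_eq_iff_eq, splitBits_getD w w' hw, Prod.ext_iff]
  simp only [cat_apply, matrixUnit, Matrix.single_apply, h u u' x hu, h v v' y hv]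
  split_ifs <;> simp_all

/-- `Sends c u v s u' v'`: the operation of the circuit `c` maps the matrix unit `|u⟩⟨v|` to the
multiple `s |u'⟩⟨v'|` of a matrix unit. -/
structure Sends {G : GateSet} {n m : ℕ} (c : Circuit G n m) (u v : List Bool) (s : ℂ)
    (u' v' : List Bool) : Prop where
  length_u : u.length = n
  length_v : v.length = n
  length_u' : u'.length = m
  length_v' : v'.length = m
  op : c.op (matrixUnit n u v) = s • matrixUnit m u' v'

namespace Sends

variable {G : GateSet} {n m k n' m' : ℕ} {u v u' v' u'' v'' w w' z z' : List Bool} {s t : ℂ}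

theorem seq {c : Circuit G n k} {d : Circuit G k m} (hc : Sends c u v s u' v')
    (hd : Sends d u' v' t u'' v'') : Sends (c.seq d) u v (s * t) u'' v'' :=
  ⟨hc.1, hc.2, hd.3, hd.4, by
    change d.op (c.op _) = _
    rw [hc.op, map_smul, hd.op, smul_smul]⟩

theorem par {c : Circuit G n m} {d : Circuit G n' m'} (hc : Sends c u v s u' v')
    (hd : Sends d w z t w' z') :
    Sends (c.par d) (u ++ w) (v ++ z) (s * t) (u' ++ w') (v' ++ z') := by
  refine ⟨by simp [hc.1, hd.1], by simp [hc.2, hd.2], by simp [hc.3, hd.3],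
    by simp [hc.4, hd.4], ?_⟩
  rw [← cat_matrixUnit hc.1 hc.2, op_par_cat, hc.op, hd.op, ← cat_matrixUnit hc.3 hc.4]
  simp only [← catBilin_apply, map_smul, LinearMap.smul_apply, smul_smul]
  rw [mul_comm]

theorem wires (hu : u.length = n) (hv : v.length = n) :
    Sends (Circuit.wires n : Circuit G _ _) u v 1 u v :=
  ⟨hu, hv, hu, hv, (one_smul _ _).symm⟩

theorem cross (hu : u.length = n) (hv : v.length = n) (hw : w.length = m) (hz : z.length = m) :
    Sends (Circuit.cross n m : Circuit G _ _) (u ++ w) (v ++ z) 1 (w ++ u) (z ++ v) := by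
  refine ⟨by simp [hu, hw], by simp [hv, hz], by simp [hu, hw], by simp [hv, hz], ?_⟩
  rw [← cat_matrixUnit hu hv, op_cross_cat, cat_matrixUnit hw hz, one_smul]

theorem cast {c : Circuit G n m} (hc : Sends c u v s u' v') (hn : n = n') (hm : m = m') :
    Sends (castCircuit hn hm c) u v s u' v' := by
  subst hn hm; exact hc

theorem congr {c : Circuit G n m} (hc : Sends c u v s u' v') (hu : u = w) (hv : v = z) (hs : s = t)
    (hu' : u' = w') (hv' : v' = z') : Sends c w z t w' z' := by
  subst hu hv hs hu' hv'; exact hc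

end Sends

/-! ### The circuits of the blind taste-test -/

section Circuits

variable {G : GateSet}

theorem tasteGates_coin : tasteGates G (Fin.natAdd G.size 0) = coinGate := by
  rw [tasteGates, Fin.append_right]; rfl

theorem tasteGates_route : tasteGates G (Fin.natAdd G.size 1) = routeGate := by
  rw [tasteGates, Fin.append_right]; rfl

theorem tasteGates_select : tasteGates G (Fin.natAdd G.size 2) = selectGate := by
  rw [tasteGates, Fin.append_right]; rfl

theorem tasteGates_compare : tasteGates G (Fin.natAdd G.size 3) = compareGate := by
  rw [tasteGates, Fin.append_right]; rfl

variable (G)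

/-- The coin as a circuit. -/
noncomputable def coinCircuit : Circuit (tasteGateSet G) 0 1 := gateCircuit _ tasteGates_coin

/-- The routing of one qubit as a circuit. -/
noncomputable def routeCircuit : Circuit (tasteGateSet G) 2 3 := gateCircuit _ tasteGates_route

/-- The selection of one of two qubits as a circuit. -/
noncomputable def selectCircuit : Circuit (tasteGateSet G) 3 2 := gateCircuit _ tasteGates_select

/-- The comparison of two bits as a circuit. -/
noncomputable def compareCircuit : Circuit (tasteGateSet G) 2 1 := gateCircuit _ tasteGates_compare

/-- The circuit that routes a register of `j` qubits, followed by a classical bit, to one of two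
registers behind that bit. -/
noncomputable def routeAll : (j : ℕ) → Circuit (tasteGateSet G) (j + 1) (1 + (j + j))
  | 0 => .wires 1
  | j + 1 => castCircuit (Nat.add_comm _ _) (by omega)
      (.seq (.par (.wires 1) (routeAll j))
        (castCircuit (n := (2 + j) + j) (by omega) rfl
          (.par (.seq (.par (routeCircuit G) (.wires j))
            (castCircuit (n := 2 + (1 + j)) (by omega) rfl (.par (.wires 2) (.cross 1 j))))
            (.wires j))))

/-- The circuit that selects one of two registers of `j` qubits, according to a classical bit in
front of them, and puts that bit behind the selected register. -/
noncomputable def selectAll : (j : ℕ) → Circuit (tasteGateSet G) (1 + (j + j)) (j + 1)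
  | 0 => .wires 1
  | j + 1 => castCircuit (by omega) (Nat.add_comm _ _)
      (.seq (castCircuit (m := (2 + j) + j) rfl (by omega)
        (.par (.seq (castCircuit (m := 2 + (1 + j)) rfl (by omega) (.par (.wires 2) (.cross j 1)))
          (.par (selectCircuit G) (.wires j))) (.wires j)))
        (.par (.wires 1) (selectAll j)))

end Circuits

theorem funOp_single_eq {I J E : Type} [Fintype I] [DecidableEq I] [Fintype E] [DecidableEq J]
    [DecidableEq E] (f : I → J × E) (i i' : I) :
    funOp f (Matrix.single i i' 1) =
      (if (f i).2 = (f i').2 then (1 : ℂ) else 0) • Matrix.single (f i).1 (f i').1 1 := by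
  ext j j'
  rw [funOp_single, Matrix.smul_apply, Matrix.single_apply]
  split_ifs <;> simp_all

theorem getD_ofFn {n : ℕ} (u : List Bool) (x : Bits n) (h : u = List.ofFn x) :
    (fun i : Fin n => u.getD i false) = x := by
  subst h
  ext i
  simp [List.getD_eq_getElem?_getD]

section Semantics

variable {G : GateSet}

theorem sends_route (x y c : Bool) :
    Sends (routeCircuit G) [x, c] [y, c] 1 [c, !c && x, c && x] [c, !c && y, c && y] := by
  refine ⟨rfl, rfl, rfl, rfl, ?_⟩
  rw [routeCircuit, gateCircuit_op]
  change funOp _ _ = _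
  rw [matrixUnit, funOp_single_eq, matrixUnit]
  congr 1
  rw [getD_ofFn [c, !c && x, c && x] ![c, !c && x, c && x] rfl,
    getD_ofFn [c, !c && y, c && y] ![c, !c && y, c && y] rfl]
  rfl

theorem sends_select (c x x' y y' : Bool) :
    Sends (selectCircuit G) [c, x, y] [c, x', y']
      (if (bif c then x else y) = (bif c then x' else y') then 1 else 0)
      [bif c then y else x, c] [bif c then y' else x', c] := by
  refine ⟨rfl, rfl, rfl, rfl, ?_⟩
  rw [selectCircuit, gateCircuit_op]
  change funOp _ _ = _
  rw [matrixUnit, funOp_single_eq, matrixUnit]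
  rw [getD_ofFn [bif c then y else x, c] ![bif c then y else x, c] rfl,
    getD_ofFn [bif c then y' else x', c] ![bif c then y' else x', c] rfl]
  congr 1
  cases c <;> simp

theorem sends_routeAll (c : Bool) (u v : List Bool) {j : ℕ} (hu : u.length = j)
    (hv : v.length = j) :
    Sends (routeAll G j) (u ++ [c]) (v ++ [c]) 1
      ([c] ++ (u.map (!c && ·) ++ u.map (c && ·)))
      ([c] ++ (v.map (!c && ·) ++ v.map (c && ·))) := by
  induction j generalizing u v with
  | zero =>
    rw [List.length_eq_zero_iff] at hu hv
    subst hu hv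
    exact Sends.wires rfl rfl
  | succ j ih =>
    obtain ⟨x, u, rfl⟩ := List.exists_cons_of_length_eq_add_one hu
    obtain ⟨y, v, rfl⟩ := List.exists_cons_of_length_eq_add_one hv
    rw [List.length_cons, Nat.add_right_cancel_iff] at hu hv
    have h1 := (Sends.wires (G := tasteGateSet G) (n := 1) (u := [x]) (v := [y]) rfl rfl).par
      (ih u v hu hv)
    have h2 := (sends_route (G := G) x y c).par (Sends.wires (u := u.map (!c && ·))
      (v := v.map (!c && ·)) (n := j) (by simpa using hu) (by simpa using hv))
    have h3 := (Sends.wires (G := tasteGateSet G) (n := 2) (u := [c, !c && x]) (v := [c, !c && y])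
      rfl rfl).par (Sends.cross (u := [c && x]) (v := [c && y]) (w := u.map (!c && ·))
      (z := v.map (!c && ·)) (n := 1) (m := j) rfl rfl (by simpa using hu) (by simpa using hv))
    have h4 := (h2.seq ((h3.cast (n' := 3 + j) (by omega) rfl).congr (by simp) (by simp) rfl rfl
      rfl)).par (Sends.wires (u := u.map (c && ·)) (v := v.map (c && ·)) (n := j)
        (by simpa using hu) (by simpa using hv))
    have h5 := h1.seq ((h4.cast (n' := 1 + (1 + (j + j))) (by omega) rfl).congr (by simp)
      (by simp) rfl rfl rfl)
    exact (h5.cast _ _).congr (by simp) (by simp) (by simp) (by simp) (by simp)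

theorem sends_selectAll (c : Bool) (u v u' v' : List Bool) {j : ℕ} (hu : u.length = j)
    (hv : v.length = j) (hu' : u'.length = j) (hv' : v'.length = j) :
    Sends (selectAll G j) ([c] ++ (u ++ u')) ([c] ++ (v ++ v'))
      (if (bif c then u else u') = (bif c then v else v') then 1 else 0)
      ((bif c then u' else u) ++ [c]) ((bif c then v' else v) ++ [c]) := by
  induction j generalizing u v u' v' with
  | zero =>
    rw [List.length_eq_zero_iff] at hu hv hu' hv'
    subst hu hv hu' hv'
    simp only [Bool.cond_self, if_true]
    exact Sends.wires rfl rfl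
  | succ j ih =>
    obtain ⟨x, u, rfl⟩ := List.exists_cons_of_length_eq_add_one hu
    obtain ⟨y, v, rfl⟩ := List.exists_cons_of_length_eq_add_one hv
    obtain ⟨x', u', rfl⟩ := List.exists_cons_of_length_eq_add_one hu'
    obtain ⟨y', v', rfl⟩ := List.exists_cons_of_length_eq_add_one hv'
    rw [List.length_cons, Nat.add_right_cancel_iff] at hu hv hu' hv'
    have h1 := (Sends.wires (G := tasteGateSet G) (n := 2) (u := [c, x]) (v := [c, y]) rfl rfl).par
      (Sends.cross (u := u) (v := v) (w := [x']) (z := [y']) (m := 1) hu hv rfl rfl)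
    have h2 := (sends_select (G := G) c x y x' y').par (Sends.wires hu hv)
    have h3 := ((h1.cast (m' := 3 + j) rfl (by omega)).congr rfl rfl rfl (by simp)
      (by simp)).seq h2
    have h4 := h3.par (Sends.wires hu' hv')
    have h5 := (Sends.wires (G := tasteGateSet G) (n := 1) (u := [bif c then x' else x])
      (v := [bif c then y' else y]) rfl rfl).par (ih u v u' v' hu hv hu' hv')
    have h6 := ((h4.cast (m' := 1 + (1 + (j + j))) rfl (by omega)).congr rfl rfl rfl (by simp)
      (by simp)).seq h5
    refine (h6.cast _ _).congr (by simp) (by simp) ?_ ?_ ?_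
    · cases c <;> simp only [cond_false, cond_true, one_mul, mul_one, List.cons.injEq, ite_and] <;>
        split_ifs <;> simp
    · cases c <;> simp
    · cases c <;> simp

theorem linearMap_ext_matrixUnit {n : ℕ} {V : Type} [AddCommGroup V] [Module ℂ V]
    {f g : Op (Bits n) →ₗ[ℂ] V}
    (h : ∀ u v : List Bool, u.length = n → v.length = n →
      f (matrixUnit n u v) = g (matrixUnit n u v)) : f = g := by
  refine Matrix.ext_linearMap ℂ fun x y => LinearMap.ext_ring ?_
  have := h (List.ofFn x) (List.ofFn y) (by simp) (by simp)
  rwa [← single_eq_matrixUnit] at this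

theorem trace_matrixUnit {n : ℕ} {u v : List Bool} (hu : u.length = n) (hv : v.length = n) :
    (matrixUnit n u v).trace = if u = v then 1 else 0 := by
  subst hu
  have h : ((fun i => u.getD i false : Bits u.length) =
      (fun i => v.getD i false : Bits u.length)) ↔ u = v := by
    constructor
    · intro h
      refine List.ext_getElem hv.symm fun i h1 h2 => ?_
      simpa [List.getD_eq_getElem?_getD, h1, h2] using congrFun h ⟨i, h1⟩
    · rintro rfl; rfl
  rw [matrixUnit]
  split_ifs with h1
  · rw [h.mpr h1, Matrix.trace_single_eq_same]
  · exact Matrix.trace_single_eq_of_ne _ _ _ fun h2 => h1 (h.mp h2)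

/-- The projection on the classical bit `c`, stored in a one-qubit register. -/
noncomputable def bitProj (c : Bool) : Op (Bits 1) := matrixUnit 1 [c] [c]

theorem bitProj_eq (c : Bool) : bitProj c = Matrix.single (fun _ => c) (fun _ => c) 1 := by
  rw [bitProj, matrixUnit, getD_ofFn [c] (fun _ => c) rfl]

/-- The state with all `n` qubits equal to `0`. -/
noncomputable def zeroState (n : ℕ) : Op (Bits n) :=
  matrixUnit n (List.replicate n false) (List.replicate n false)

theorem trace_zeroState (n : ℕ) : (zeroState n).trace = 1 := by
  rw [zeroState, trace_matrixUnit (by simp) (by simp), if_pos rfl]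

/-- A register in the state `X`, behind which the bit `c` is stored, is moved to the place `c`. -/
theorem routeAll_op {n : ℕ} (c : Bool) (X : Op (Bits n)) :
    (routeAll G n).op (cat X (bitProj c)) =
      cat (bitProj c) (cat (bif c then zeroState n else X) (bif c then X else zeroState n)) := by
  have h : (routeAll G n).op ∘ₗ (catBilin n 1).flip (bitProj c) =
      catBilin _ _ (bitProj c) ∘ₗ (bif c then catBilin n n (zeroState n) else
        (catBilin n n).flip (zeroState n)) := by
    refine linearMap_ext_matrixUnit fun u v hu hv => ?_
    have hs := (sends_routeAll (G := G) c u v hu hv).op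
    rw [one_smul, ← cat_matrixUnit (b := 1) hu hv, ← cat_matrixUnit (a := 1) rfl rfl,
      ← cat_matrixUnit (by simpa using hu) (by simpa using hv)] at hs
    simp only [LinearMap.comp_apply, LinearMap.flip_apply, catBilin_apply]
    refine hs.trans ?_
    have hm : ∀ w : List Bool, w.length = n →
        w.map (fun _ => false) = List.replicate n false := by
      rintro w rfl; simp
    cases c <;> simp [catBilin_apply, zeroState, hm u hu, hm v hv, bitProj]
  have := LinearMap.congr_fun h X
  simp only [LinearMap.comp_apply, LinearMap.flip_apply, catBilin_apply] at this
  rw [this]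
  cases c <;> rfl

/-- The register at the place `c` is kept, and the other one is discarded, which leaves its trace
as a factor. -/
theorem selectAll_op {m : ℕ} (c : Bool) (X Y : Op (Bits m)) :
    (selectAll G m).op (cat (bitProj c) (cat X Y)) =
      (bif c then X.trace else Y.trace) • cat (bif c then Y else X) (bitProj c) := by
  let f : Op (Bits m) →ₗ[ℂ] Op (Bits m) →ₗ[ℂ] Op (Bits (m + 1)) :=
    (catBilin m m).compr₂ ((selectAll G m).op ∘ₗ catBilin 1 (m + m) (bitProj c))
  let g₀ : Op (Bits m) →ₗ[ℂ] Op (Bits m) →ₗ[ℂ] Op (Bits (m + 1)) :=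
    (LinearMap.lsmul ℂ _).comp (Matrix.traceLinearMap (Bits m) ℂ ℂ) |>.compl₂
      ((catBilin m 1).flip (bitProj c))
  let g : Op (Bits m) →ₗ[ℂ] Op (Bits m) →ₗ[ℂ] Op (Bits (m + 1)) := bif c then g₀ else g₀.flip
  have h : f = g := by
    refine linearMap_ext_matrixUnit fun u v hu hv => linearMap_ext_matrixUnit
      fun u' v' hu' hv' => ?_
    have hs := (sends_selectAll (G := G) c u v u' v' hu hv hu' hv').op
    rw [← cat_matrixUnit (a := 1) rfl rfl, ← cat_matrixUnit (b := m) hu hv] at hs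
    refine hs.trans ?_
    cases c
    · change _ = (matrixUnit m u' v').trace • cat (matrixUnit m u v) (bitProj false)
      rw [trace_matrixUnit hu' hv', bitProj, cat_matrixUnit hu hv]
      rfl
    · change _ = (matrixUnit m u v).trace • cat (matrixUnit m u' v') (bitProj true)
      rw [trace_matrixUnit hu hv, bitProj, cat_matrixUnit hu' hv']
      rfl
  have := LinearMap.congr_fun₂ h X Y
  refine this.trans ?_
  cases c <;> rfl

theorem coinCircuit_op :
    (coinCircuit G).op 1 = (1 / 2 : ℂ) • (bitProj false + bitProj true) := by
  rw [coinCircuit, gateCircuit_op]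
  ext j j'
  refine (coinGate_op_apply 1 j j').trans ?_
  obtain ⟨a, rfl⟩ : ∃ a : Bool, j = fun _ => a := ⟨j 0, by ext i; rw [Subsingleton.elim i 0]⟩
  obtain ⟨b, rfl⟩ : ∃ a : Bool, j' = fun _ => a := ⟨j' 0, by ext i; rw [Subsingleton.elim i 0]⟩
  rw [bitProj_eq, bitProj_eq]
  have h : ∀ a b : Bool, ((fun _ : Fin 1 => a) = fun _ => b) ↔ a = b :=
    fun a b => ⟨fun h => congrFun h 0, fun h => by rw [h]⟩
  simp only [Matrix.smul_apply, Matrix.add_apply, Matrix.single_apply, h, Matrix.one_apply_eq]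
  cases a <;> cases b <;> simp

end Semantics

section Verifier

variable {G : GateSet} {n m : ℕ}

/-- The circuit of the second step of the blind taste-test: toss a coin `i`, route the register to
the circuit `Q_i`, the other circuit getting zeros, and select the output of `Q_i`. -/
noncomputable def challengeCircuit (Q₀ Q₁ : Circuit G n m) :
    Circuit (tasteGateSet G) n (1 + m) :=
  .seq (castCircuit (n := n + 0) rfl rfl (.par (.wires n) (coinCircuit G)))
    (.seq (routeAll G n)
      (.seq (.par (.wires 1) (.par (liftCircuit Q₀) (liftCircuit Q₁)))
        (.seq (selectAll G m) (.cross m 1))))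

theorem cat_one_zero (X : Op (Bits n)) : cat X (1 : Op (Bits 0)) = X := by
  ext x y
  rw [cat_apply, Subsingleton.elim (splitBits n 0 x).2 (splitBits n 0 y).2, Matrix.one_apply_eq,
    mul_one]
  rfl

theorem challengeCircuit_op (Q₀ Q₁ : Circuit G n m) (X : Op (Bits n)) :
    (challengeCircuit Q₀ Q₁).op X =
      (1 / 2 : ℂ) • (cat (bitProj false) (Q₀.op X) + cat (bitProj true) (Q₁.op X)) := by
  change (Circuit.cross m 1 : Circuit (tasteGateSet G) _ _).op ((selectAll G m).op
    ((Circuit.par (.wires 1) (.par (liftCircuit Q₀) (liftCircuit Q₁))).op ((routeAll G n).op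
      ((Circuit.par (.wires n) (coinCircuit G)).op X)))) = _
  have h1 : (Circuit.par (.wires n) (coinCircuit G)).op X =
      (1 / 2 : ℂ) • (cat X (bitProj false) + cat X (bitProj true)) := by
    conv_lhs => rw [← cat_one_zero X]
    rw [op_par_cat, coinCircuit_op]
    simp only [← catBilin_apply, map_smul, map_add]
    rfl
  rw [h1]
  have hw : ∀ (k : ℕ) (Y : Op (Bits k)),
      (Circuit.wires k : Circuit (tasteGateSet G) k k).op Y = Y := fun _ _ => rfl
  simp only [map_smul, map_add, routeAll_op, op_par_cat, hw, selectAll_op, op_cross_cat,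
    liftCircuit_op, cond_false, cond_true, (preservesTraceStar_circuit _).trace, trace_zeroState,
    one_smul]

/-- The verifier circuits of the blind taste-test. -/
noncomputable def tasteVerifier (Q₀ Q₁ : Circuit G n m) : VerifierCircuits (tasteGateSet G) 0 :=
  .round n m 1 (castCircuit (Nat.zero_add n).symm rfl (challengeCircuit Q₀ Q₁))
    (.decide 1 (compareCircuit G))

theorem castCircuit_op_rename {k : ℕ} (h : n = k) (c : Circuit G n m)
    (e : Bits 0 × Bits n ≃ Bits k) (he : ∀ b i, e b (Fin.cast h i) = b.2 i) :
    (castCircuit h rfl c).op ∘ₗ rename e = c.op ∘ₗ rename (Equiv.uniqueProd (Bits n) (Bits 0)) := by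
  subst h
  congr 2
  ext b i
  exact he b i

theorem tasteVerifier_toVerifier (Q₀ Q₁ : Circuit G n m) :
    (tasteVerifier Q₀ Q₁).toVerifier = blindTasteTest Q₀.op Q₁.op := by
  have h1 : rename (splitBits 1 m) ∘ₗ (castCircuit (Nat.zero_add n).symm rfl
      (challengeCircuit Q₀ Q₁)).op ∘ₗ rename (splitBits 0 n).symm =
      tasteChallenge Q₀.op Q₁.op := by
    rw [castCircuit_op_rename]
    · rw [tasteChallenge, ← LinearMap.comp_assoc]
      congr 1
      refine LinearMap.ext fun X => ?_
      have hr : ∀ (c : Bool) (Y : Op (Bits m)),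
          rename (splitBits 1 m) (cat (bitProj c) Y) = attachBit c Y := by
        intro c Y
        rw [bitProj_eq]
        ext x y
        change (_ ⊗ₖ Y) (splitBits 1 m ((splitBits 1 m).symm x))
          (splitBits 1 m ((splitBits 1 m).symm y)) = _
        simp only [Equiv.apply_symm_apply]
        rfl
      simp only [LinearMap.comp_apply, challengeCircuit_op, map_smul, map_add, hr,
        LinearMap.add_apply, LinearMap.smul_apply, smul_add]
    · intro b i
      change Fin.append b.1 b.2 _ = _
      have : Fin.cast (Nat.zero_add n).symm i = Fin.natAdd 0 i := by
        ext; simp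
      rw [this, Fin.append_right]
  have h2 : (compareCircuit G).op ∘ₗ rename (splitBits 1 1).symm = tasteDecision := by
    rw [compareCircuit, gateCircuit_op]
    change (tasteDecision ∘ₗ rename (splitBits 1 1)) ∘ₗ rename (splitBits 1 1).symm = _
    rw [LinearMap.comp_assoc]
    refine LinearMap.ext fun X => ?_
    change tasteDecision (X.submatrix (fun i => (splitBits 1 1) ((splitBits 1 1).symm i))
      fun i => (splitBits 1 1) ((splitBits 1 1).symm i)) = _
    simp only [Equiv.apply_symm_apply]
    rfl
  rw [blindTasteTest, ← h1, ← h2]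
  rfl

end Verifier

end GatesAndCircuits

/-! ### The polynomial-time description of the verifier -/

/-- The stacks of the program that describes the verifier: input, output, the descriptions of the
two circuits, the numbers `n` and `m`, and two stacks for copying and counting. -/
inductive Stk : Type
  | inp | out | rest | n | m | tmp | cnt
  deriving DecidableEq

instance : Fintype Stk where
  elems := {.inp, .out, .rest, .n, .m, .tmp, .cnt}
  complete k := by cases k <;> decide

/-- The stacks with the given contents. -/
def contents (i o r n m t c : List Bool) : Stk → List Bool
  | .inp => i
  | .out => o
  | .rest => r
  | .n => n
  | .m => m
  | .tmp => t
  | .cnt => c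

section Update

variable (i o r n m t c x : List Bool)

@[simp] theorem update_inp :
    Function.update (contents i o r n m t c) .inp x = contents x o r n m t c := by
  ext k : 1; cases k <;> rfl

@[simp] theorem update_out :
    Function.update (contents i o r n m t c) .out x = contents i x r n m t c := by
  ext k : 1; cases k <;> rfl

@[simp] theorem update_rest :
    Function.update (contents i o r n m t c) .rest x = contents i o x n m t c := by
  ext k : 1; cases k <;> rfl

@[simp] theorem update_n :
    Function.update (contents i o r n m t c) .n x = contents i o r x m t c := by
  ext k : 1; cases k <;> rfl

@[simp] theorem update_m :
    Function.update (contents i o r n m t c) .m x = contents i o r n x t c := by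
  ext k : 1; cases k <;> rfl

@[simp] theorem update_tmp :
    Function.update (contents i o r n m t c) .tmp x = contents i o r n m x c := by
  ext k : 1; cases k <;> rfl

@[simp] theorem update_cnt :
    Function.update (contents i o r n m t c) .cnt x = contents i o r n m t x := by
  ext k : 1; cases k <;> rfl

end Update

open StackProg

/-- A string of `n` times the symbol `true`. -/
abbrev ones (n : ℕ) : List Bool := List.replicate n true

/-- The program `P` puts `w` on the output stack, when the stacks `n`, `m` and `cnt` hold the
numbers `a`, `b` and `c`. -/
def Emits (a b c : ℕ) (P : StackProg Stk) (T : ℕ) (w : List Bool) : Prop :=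
  ∀ o r, P.RunsIn (contents [] o r (ones a) (ones b) [] (ones c)) T
    (contents [] (w ++ o) r (ones a) (ones b) [] (ones c))

/-- As strings are put on a stack, the last part of a string is emitted first. -/
theorem Emits.append {a b c T T' : ℕ} {P Q : StackProg Stk} {w w' : List Bool}
    (hP : Emits a b c P T w) (hQ : Emits a b c Q T' w') :
    Emits a b c (Q.seq P) (T' + T) (w ++ w') := by
  intro o r
  have := (hQ o r).seq (hP _ r)
  rwa [← List.append_assoc] at this

theorem Emits.mono {a b c T T' : ℕ} {P : StackProg Stk} {w : List Bool} (hP : Emits a b c P T w)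
    (h : T ≤ T') : Emits a b c P T' w :=
  fun o r => (hP o r).mono h

theorem emits_emit {a b c : ℕ} (w : List Bool) : Emits a b c (.emit .out w) 1 w :=
  fun _ _ => .emit (by simp [contents])

/-- The program that puts the self-delimiting code of the number on the stack `k` on the output
stack. -/
def emitUnary (k : Stk) : StackProg Stk :=
  .seq (.emit .out [false])
    (.seq (.loop k (.seq (.emit .out [true]) (.emit .tmp [true])))
      (.loop .tmp (.emit k [true])))

theorem ones_sub {i j : ℕ} (h : i < j) : ones (j - i) = true :: ones (j - (i + 1)) := by
  rw [← List.replicate_succ]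
  congr 1
  omega

/-- Emitting the code of a number, for a family `F o x t` of stacks with output `o`, with `x` on
the stack `k`, and with `t` on the stack for copying. -/
theorem runsIn_emitUnary (k : Stk) (F : List Bool → List Bool → List Bool → Stk → List Bool)
    (hout : ∀ o x t, F o x t .out = o) (hk : ∀ o x t, F o x t k = x)
    (htmp : ∀ o x t, F o x t .tmp = t)
    (uout : ∀ o x t y, Function.update (F o x t) .out y = F y x t)
    (uk : ∀ o x t y, Function.update (F o x t) k y = F o y t)
    (utmp : ∀ o x t y, Function.update (F o x t) .tmp y = F o x y) (j : ℕ) (o : List Bool) :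
    (emitUnary k).RunsIn (F o (ones j) []) (5 * j + 3) (F (unary j ++ o) (ones j) []) := by
  have h1 : (StackProg.emit .out [false]).RunsIn (F o (ones j) []) 1
      (F (false :: o) (ones j) []) := .emit (by simp [hout, uout])
  have h2 := RunsIn.loop (P := .seq (.emit .out [true]) (.emit .tmp [true])) (k := k) (T := 2)
    (n := j) (S' := F (ones j ++ false :: o) [] (ones j))
    (fun i => F (ones (j - i) ++ false :: o) (ones i) (ones (j - i)))
    (fun i hi => ⟨ones i, by simp [hk, List.replicate_succ], RunsIn.seq (T := 1) (T' := 1)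
      (.emit rfl) (.emit (by simp [hout, htmp, uout, uk, utmp, ones_sub hi]))⟩)
    (by simp [hk]) (by simp [hk, uk])
  have h3 := RunsIn.loop (P := .emit k [true]) (k := .tmp) (T := 1)
    (n := j) (S' := F (ones j ++ false :: o) (ones j) [])
    (fun i => F (ones j ++ false :: o) (ones (j - i)) (ones i))
    (fun i hi => ⟨ones i, by simp [htmp, List.replicate_succ],
      .emit (by simp [hk, uk, utmp, ones_sub hi])⟩)
    (by simp [htmp]) (by simp [htmp, utmp])
  simp only [Nat.sub_self] at h2 h3
  have h4 := h1.seq (h2.seq h3)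
  refine RunsIn.mono (T := 1 + (j * (2 + 1) + 1 + (j * (1 + 1) + 1))) ?_ (le_of_eq ?_)
  · rw [emitUnary, unary, List.append_assoc]
    exact h4
  · ring

theorem emits_unary_n {a b c : ℕ} : Emits a b c (emitUnary .n) (5 * a + 3) (unary a) :=
  fun o r => runsIn_emitUnary .n (fun o x t => contents [] o r x (ones b) t (ones c))
    (fun _ _ _ => rfl) (fun _ _ _ => rfl) (fun _ _ _ => rfl) (by simp) (by simp) (by simp) a o

theorem emits_unary_m {a b c : ℕ} : Emits a b c (emitUnary .m) (5 * b + 3) (unary b) :=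
  fun o r => runsIn_emitUnary .m (fun o x t => contents [] o r (ones a) x t (ones c))
    (fun _ _ _ => rfl) (fun _ _ _ => rfl) (fun _ _ _ => rfl) (by simp) (by simp) (by simp) b o

theorem emits_unary_cnt {a b c : ℕ} : Emits a b c (emitUnary .cnt) (5 * c + 3) (unary c) :=
  fun o r => runsIn_emitUnary .cnt (fun o x t => contents [] o r (ones a) (ones b) t x)
    (fun _ _ _ => rfl) (fun _ _ _ => rfl) (fun _ _ _ => rfl) (by simp) (by simp) (by simp) c o

section Programs

variable (G : GateSet)

/-- The part of the description of `routeAll G (j + 1)` behind the description of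
`routeAll G j`. -/
def routeTail (j : ℕ) : List Bool :=
  [true, true, true, false, true, true, false, false] ++ unary (G.size + 1) ++
    [false, true, false] ++ (unary j ++ ([true, true, false, true, false] ++ unary 2 ++
    [false, true, true] ++ unary 1 ++ (unary j ++ ([false, true, false] ++ unary j))))

/-- The part of the description of `routeAll G (j + 1)` before the description of
`routeAll G j`. -/
def routeHead : List Bool := [true, false, true, true, false, true, false] ++ unary 1

theorem routeAll_encode_succ (j : ℕ) :
    (routeAll G (j + 1)).encode = routeHead ++ (routeAll G j).encode ++ routeTail G j := by
  rw [routeAll, castCircuit_encode]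
  simp only [Circuit.encode, castCircuit_encode, routeCircuit, gateCircuit_encode]
  simp [routeHead, routeTail]

theorem routeAll_encode (j : ℕ) :
    (routeAll G j).encode = (List.replicate j routeHead).flatten ++
      ([false, true, false] ++ unary 1) ++ (List.range j).flatMap (routeTail G) := by
  induction j with
  | zero => rfl
  | succ j ih =>
    rw [routeAll_encode_succ, ih, List.range_succ, List.replicate_succ]
    simp

/-- The program that emits `routeTail G j`. -/
def emitRouteTail : StackProg Stk :=
  .seq (.seq (.seq (.seq (.seq (emitUnary .n) (.emit .out [false, true, false])) (emitUnary .n))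
    (.emit .out ([true, true, false, true, false] ++ unary 2 ++ [false, true, true] ++ unary 1)))
    (emitUnary .n)) (.emit .out ([true, true, true, false, true, true, false, false] ++
      unary (G.size + 1) ++ [false, true, false]))

theorem emits_routeTail (j b c : ℕ) :
    Emits j b c (emitRouteTail G) (15 * j + 12) (routeTail G j) := by
  have h : Emits j b c (emitRouteTail G) _ (routeTail G j) :=
    (emits_emit _).append (emits_unary_n.append ((emits_emit _).append
      (emits_unary_n.append ((emits_emit _).append emits_unary_n))))
  exact h.mono (by omega)

/-- The program that emits the description of `routeAll G n`. -/
def emitRoute : StackProg Stk :=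
  .seq (.loop .n (.seq (emitRouteTail G) (.emit .cnt [true])))
    (.seq (.emit .out ([false, true, false] ++ unary 1))
      (.loop .cnt (.seq (.emit .out routeHead) (.emit .n [true]))))

theorem emits_route (a b : ℕ) :
    Emits a b 0 (emitRoute G) (a * (15 * a + 17) + 3) (routeAll G a).encode := by
  intro o r
  have h1 := RunsIn.loop (P := .seq (emitRouteTail G) (.emit .cnt [true])) (k := .n)
    (T := 15 * a + 12 + 1) (n := a)
    (S' := contents [] ((List.range a).flatMap (routeTail G) ++ o) r [] (ones b) [] (ones a))
    (fun i => contents [] ((List.range' i (a - i)).flatMap (routeTail G) ++ o) r (ones i) (ones b)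
      [] (ones (a - i)))
    (fun i hi => ⟨ones i, by simp [contents, List.replicate_succ], RunsIn.seq
      (RunsIn.mono (by rw [update_n]; exact emits_routeTail G i b _ _ _) (by omega))
      (.emit (by
        obtain ⟨k, rfl⟩ := Nat.exists_eq_add_of_lt hi
        simp [contents, show i + k + 1 - i = k + 1 by omega,
          show i + k + 1 - (i + 1) = k by omega, List.range'_succ, List.replicate_succ]))⟩)
    (by simp [contents]) (by simp [contents, List.range_eq_range'])
  have h2 : (StackProg.emit .out ([false, true, false] ++ unary 1)).RunsIn
      (contents [] ((List.range a).flatMap (routeTail G) ++ o) r [] (ones b) [] (ones a)) 1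
      (contents []
        (([false, true, false] ++ unary 1) ++ ((List.range a).flatMap (routeTail G) ++ o)) r []
        (ones b) [] (ones a)) := .emit (by simp [contents])
  have h3 := RunsIn.loop (P := .seq (.emit .out routeHead) (.emit .n [true])) (k := .cnt)
    (T := 2) (n := a)
    (S' := contents [] ((routeAll G a).encode ++ o) r (ones a) (ones b) [] [])
    (fun i => contents [] ((List.replicate (a - i) routeHead).flatten ++
      (([false, true, false] ++ unary 1) ++ ((List.range a).flatMap (routeTail G) ++ o)))
        r (ones (a - i)) (ones b) [] (ones i))
    (fun i hi => ⟨ones i, by simp [contents, List.replicate_succ], RunsIn.seq (T := 1) (T' := 1)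
      (.emit rfl) (.emit (by
        simp [contents, show a - i = a - (i + 1) + 1 by omega, List.replicate_succ]))⟩)
    (by simp [contents]) (by simp [contents, routeAll_encode])
  simp only [Nat.sub_self] at h1 h3
  exact (h1.seq (h2.seq h3)).mono (by ring_nf; omega)

/-- The part of the description of `selectAll G (j + 1)` before the description of
`selectAll G j`. -/
def selectHead (j : ℕ) : List Bool :=
  ([true, false, true, true, true, false, true, true, false, true, false] ++ unary 2 ++
    [false, true, true]) ++ (unary j ++ ((unary 1 ++ [true, true, false, false] ++
    unary (G.size + 2) ++ [false, true, false]) ++ (unary j ++ ([false, true, false] ++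
    (unary j ++ ([true, true, false, true, false] ++ unary 1))))))

theorem selectAll_encode_succ (j : ℕ) :
    (selectAll G (j + 1)).encode = selectHead G j ++ (selectAll G j).encode := by
  rw [selectAll, castCircuit_encode]
  simp only [Circuit.encode, castCircuit_encode, selectCircuit, gateCircuit_encode]
  simp [selectHead]

/-- The program that emits `selectHead G j`, with `j` on the stack `cnt`. -/
def emitSelectHead : StackProg Stk :=
  .seq (.seq (.seq (.seq (.seq (.seq (.emit .out ([true, true, false, true, false] ++ unary 1))
    (emitUnary .cnt)) (.emit .out [false, true, false])) (emitUnary .cnt))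
    (.emit .out (unary 1 ++ [true, true, false, false] ++ unary (G.size + 2) ++
      [false, true, false]))) (emitUnary .cnt))
    (.emit .out ([true, false, true, true, true, false, true, true, false, true, false] ++
      unary 2 ++ [false, true, true]))

theorem emits_selectHead (a b j : ℕ) :
    Emits a b j (emitSelectHead G) (15 * j + 13) (selectHead G j) := by
  have h : Emits a b j (emitSelectHead G) _ (selectHead G j) :=
    (emits_emit _).append (emits_unary_cnt.append ((emits_emit _).append
      (emits_unary_cnt.append ((emits_emit _).append (emits_unary_cnt.append (emits_emit _))))))
  exact h.mono (by omega)

/-- The program that emits the description of `selectAll G m`. -/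
def emitSelect : StackProg Stk :=
  .seq (.emit .out ([false, true, false] ++ unary 1))
    (.seq (.loop .m (.seq (emitSelectHead G) (.emit .cnt [true])))
      (.loop .cnt (.emit .m [true])))

theorem emits_select (a b : ℕ) :
    Emits a b 0 (emitSelect G) (b * (15 * b + 17) + 3) (selectAll G b).encode := by
  intro o r
  obtain ⟨e, he⟩ : ∃ e : ℕ → List Bool, ∀ j, e j = (selectAll G j).encode := ⟨_, fun _ => rfl⟩
  have hsucc : ∀ j, e (j + 1) = selectHead G j ++ e j := fun j => by
    rw [he, he, selectAll_encode_succ]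
  rw [← he]
  have h1 : (StackProg.emit .out ([false, true, false] ++ unary 1)).RunsIn
      (contents [] o r (ones a) (ones b) [] []) 1
      (contents [] (e 0 ++ o) r (ones a) (ones b) [] []) :=
    .emit (by rw [update_out, he]; rfl)
  have h2 := RunsIn.loop (P := .seq (emitSelectHead G) (.emit .cnt [true])) (k := .m)
    (T := 15 * b + 13 + 1) (n := b)
    (S' := contents [] (e b ++ o) r (ones a) [] [] (ones b))
    (fun i => contents [] (e (b - i) ++ o) r (ones a) (ones i) []
      (ones (b - i)))
    (fun i hi => ⟨ones i, by simp [contents, List.replicate_succ], RunsIn.seq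
      (RunsIn.mono (by rw [update_m]; exact emits_selectHead G a i _ _ _) (by omega))
      (.emit (by
        simp [contents, show b - i = b - (i + 1) + 1 by omega, hsucc, List.replicate_succ]))⟩)
    (by simp [contents]) (by simp [contents])
  have h3 := RunsIn.loop (P := .emit .m [true]) (k := .cnt) (T := 1) (n := b)
    (S' := contents [] (e b ++ o) r (ones a) (ones b) [] [])
    (fun i => contents [] (e b ++ o) r (ones a) (ones (b - i)) [] (ones i))
    (fun i hi => ⟨ones i, by simp [contents, List.replicate_succ],
      .emit (by simp [contents, ones_sub hi])⟩)
    (by simp [contents]) (by simp [contents])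
  simp only [Nat.sub_self] at h2 h3
  exact (h1.seq (h2.seq h3)).mono (by ring_nf; omega)

/-- The part of the description of the verifier before the descriptions of the two circuits. -/
noncomputable def describeFront (n m : ℕ) : List Bool :=
  [true] ++ (unary n ++ (unary m ++ ((unary 1 ++ [true, false, true, true, false, true, false]) ++
    (unary n ++ (([false, false] ++ unary G.size ++ [true, false]) ++ ((routeAll G n).encode ++
    ([true, false, true, true, false, true, false] ++ unary 1 ++ [true, true])))))))

/-- The part of the description of the verifier behind the descriptions of the two circuits. -/
noncomputable def describeBack (m : ℕ) : List Bool :=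
  [true, false] ++ ((selectAll G m).encode ++ ([false, true, true] ++ (unary m ++
    (unary 1 ++ [false] ++ unary 1 ++ [false, false] ++ unary (G.size + 3)))))

/-- The description of the verifier for two circuits of type `(n, m)`, where `w` consists of the
descriptions of these circuits. -/
noncomputable def describe (n m : ℕ) (w : List Bool) : List Bool :=
  describeFront G n m ++ w ++ describeBack G m

theorem tasteVerifier_encode {n m : ℕ} (Q₀ Q₁ : Circuit G n m) :
    (tasteVerifier Q₀ Q₁).encode = describe G n m (Q₀.encode ++ Q₁.encode) := by
  have h1 : (challengeCircuit Q₀ Q₁).encode = [true, false] ++ ([true, true] ++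
      ([false, true, false] ++ unary n) ++ (coinCircuit G).encode) ++ ([true, false] ++
      (routeAll G n).encode ++ ([true, false] ++ ([true, true] ++
      ([false, true, false] ++ unary 1) ++ ([true, true] ++ (liftCircuit Q₀).encode ++
      (liftCircuit Q₁).encode)) ++ ([true, false] ++ (selectAll G m).encode ++
      ([false, true, true] ++ unary m ++ unary 1)))) := rfl
  rw [tasteVerifier]
  simp only [VerifierCircuits.encode, castCircuit_encode, h1, coinCircuit, compareCircuit,
    gateCircuit_encode, liftCircuit_encode, describe, describeFront, describeBack]
  simp

/-- The program that emits `describeFront G n m`. -/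
def emitFront : StackProg Stk :=
  .seq (.seq (.seq (.seq (.seq (.seq (.seq
    (.emit .out ([true, false, true, true, false, true, false] ++ unary 1 ++ [true, true]))
    (emitRoute G)) (.emit .out ([false, false] ++ unary G.size ++ [true, false]))) (emitUnary .n))
    (.emit .out (unary 1 ++ [true, false, true, true, false, true, false]))) (emitUnary .m))
    (emitUnary .n)) (.emit .out [true])

theorem emits_front (a b : ℕ) :
    Emits a b 0 (emitFront G) (a * (15 * a + 27) + 5 * b + 16) (describeFront G a b) := by
  have h : Emits a b 0 (emitFront G) _ (describeFront G a b) :=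
    (emits_emit _).append (emits_unary_n.append (emits_unary_m.append ((emits_emit _).append
      (emits_unary_n.append ((emits_emit _).append ((emits_route G a b).append
        (emits_emit _)))))))
  exact h.mono (by ring_nf; omega)

/-- The program that emits `describeBack G m`. -/
def emitBack : StackProg Stk :=
  .seq (.seq (.seq (.seq
    (.emit .out (unary 1 ++ [false] ++ unary 1 ++ [false, false] ++ unary (G.size + 3)))
    (emitUnary .m)) (.emit .out [false, true, true])) (emitSelect G)) (.emit .out [true, false])

theorem emits_back (a b : ℕ) :
    Emits a b 0 (emitBack G) (b * (15 * b + 22) + 9) (describeBack G b) := by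
  have h : Emits a b 0 (emitBack G) _ (describeBack G b) :=
    (emits_emit _).append ((emits_select G a b).append ((emits_emit _).append
      (emits_unary_m.append (emits_emit _))))
  exact h.mono (by ring_nf; omega)

/-- Reading a number in self-delimiting code: the number and the remaining string. -/
def readUnary (x : List Bool) : ℕ × List Bool :=
  ((x.takeWhile id).length, (x.dropWhile id).tail)

theorem readUnary_unary (n : ℕ) (w : List Bool) : readUnary (unary n ++ w) = (n, w) := by
  induction n with
  | zero => rfl
  | succ n ih =>
    rw [unary, List.replicate_succ]
    simp only [readUnary, Prod.mk.injEq, List.cons_append]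
    simp

theorem readUnary_length (x : List Bool) : (readUnary x).1 + (readUnary x).2.length ≤ x.length := by
  have h := congrArg List.length (List.takeWhile_append_dropWhile (p := id) (l := x))
  rw [List.length_append] at h
  simp only [readUnary, List.length_tail]
  omega

/-- Reading a number from the input, for a family `F i x` of stacks with input `i` and with `x` on
the stack `k`. -/
theorem runsIn_readUnary (k : Stk) (F : List Bool → List Bool → Stk → List Bool)
    (hinp : ∀ i x, F i x .inp = i) (hk : ∀ i x, F i x k = x)
    (uinp : ∀ i x y, Function.update (F i x) .inp y = F y x)
    (uk : ∀ i x y, Function.update (F i x) k y = F i y) (x : List Bool) :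
    (StackProg.loop .inp (.emit k [true])).RunsIn (F x []) (2 * x.length + 1)
      (F (readUnary x).2 (ones (readUnary x).1)) := by
  have hones : ∀ x : List Bool, x.takeWhile id = ones (x.takeWhile id).length := fun x =>
    List.eq_replicate_iff.mpr ⟨rfl, fun b hb => by simpa using List.mem_takeWhile_imp hb⟩
  have hx : ones (readUnary x).1 ++ x.dropWhile id = x := by
    conv_rhs => rw [← List.takeWhile_append_dropWhile (p := id) (l := x), hones x]
    rfl
  have h := RunsIn.loop (P := .emit k [true]) (k := .inp) (T := 1) (n := (readUnary x).1)
    (S' := F (readUnary x).2 (ones (readUnary x).1))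
    (fun j => F (ones j ++ x.dropWhile id) (ones ((readUnary x).1 - j)))
    (fun j hj => ⟨ones j ++ x.dropWhile id, by simp [hinp, List.replicate_succ],
      .emit (by simp [hk, uinp, uk, ones_sub hj])⟩)
    (by
      simp only [hinp, List.replicate_zero, List.nil_append]
      intro h
      have := List.head?_dropWhile_not id x
      rw [h] at this
      simp at this)
    (by simp [hinp, uinp, readUnary])
  simp only [hx, Nat.sub_self] at h
  exact h.mono (by have := readUnary_length x; omega)

/-- The function that maps the description of a pair of circuits to the description of the
verifier. -/
noncomputable def reduction (x : List Bool) : List Bool :=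
  describe G (readUnary x).1 (readUnary (readUnary x).2).1 (readUnary (readUnary x).2).2

theorem reduction_encodePair {n m : ℕ} (Q₀ Q₁ : Circuit G n m) :
    reduction G (encodePair Q₀ Q₁) = (tasteVerifier Q₀ Q₁).encode := by
  rw [tasteVerifier_encode, reduction, encodePair]
  simp only [List.append_assoc, readUnary_unary]

/-- The program for `reduction`: read the two numbers, put the rest aside, emit the description of
the verifier from back to front, and clear the stacks. -/
def reductionProg : StackProg Stk :=
  .seq (.loop .inp (.emit .n [true])) (.seq (.loop .inp (.emit .m [true]))
    (.seq (.move .inp .rest) (.seq (emitBack G) (.seq (.move .rest .out) (.seq (emitFront G)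
      (.seq (.loop .n (.emit .inp [])) (.loop .m (.emit .inp []))))))))

theorem polyTime_reduction : PolyTime (reduction G) := by
  refine polyTime_of_runsIn (reductionProg G) .inp .out
    (30 * Polynomial.X ^ 2 + 100 * Polynomial.X + 100) fun x => ?_
  obtain ⟨a, y, hay⟩ : ∃ a y, readUnary x = (a, y) := ⟨_, _, rfl⟩
  obtain ⟨b, w, hbw⟩ : ∃ b w, readUnary y = (b, w) := ⟨_, _, rfl⟩
  have hx := readUnary_length x
  have hy := readUnary_length y
  simp only [hay, hbw] at hx hy
  have hr : reduction G x = describe G a b w := by simp only [reduction, hay, hbw]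
  have h0 : ∀ u, Function.update (fun _ => []) Stk.inp u = contents u [] [] [] [] [] [] := by
    intro u; ext k : 1; cases k <;> rfl
  have h0' : ∀ u, Function.update (fun _ => []) Stk.out u = contents [] u [] [] [] [] [] := by
    intro u; ext k : 1; cases k <;> rfl
  have h1 := runsIn_readUnary .n (fun i x => contents i [] [] x [] [] []) (fun _ _ => rfl)
    (fun _ _ => rfl) (by simp) (by simp) x
  have h2 := runsIn_readUnary .m (fun i x => contents i [] [] (ones a) x [] []) (fun _ _ => rfl)
    (fun _ _ => rfl) (by simp) (by simp) y
  simp only [hay, hbw] at h1 h2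
  have h3 : (StackProg.move .inp .rest).RunsIn (contents w [] [] (ones a) (ones b) [] [])
      (w.length + 1) (contents [] [] w.reverse (ones a) (ones b) [] []) :=
    RunsIn.move (by decide) le_rfl (by simp [contents])
  have h4 := emits_back G a b [] w.reverse
  have h5 : (StackProg.move .rest .out).RunsIn
      (contents [] (describeBack G b ++ []) w.reverse (ones a) (ones b) [] []) (w.length + 1)
      (contents [] (w ++ describeBack G b) [] (ones a) (ones b) [] []) :=
    RunsIn.move (by decide) (by simp [contents]) (by simp [contents])
  have h6 := emits_front G a b (w ++ describeBack G b) []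
  have h7 : (StackProg.loop .n (.emit .inp [])).RunsIn
      (contents [] (describeFront G a b ++ (w ++ describeBack G b)) [] (ones a) (ones b) [] [])
      (a * (1 + 1) + 1)
      (contents [] (describeFront G a b ++ (w ++ describeBack G b)) [] [] (ones b) [] []) :=
    RunsIn.loop (fun j => contents [] _ [] (ones j) (ones b) [] [])
      (fun j _ => ⟨ones j, rfl, .emit (by simp [contents])⟩) (by simp [contents])
      (by simp [contents])
  have h8 : (StackProg.loop .m (.emit .inp [])).RunsIn
      (contents [] (describeFront G a b ++ (w ++ describeBack G b)) [] [] (ones b) [] [])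
      (b * (1 + 1) + 1)
      (contents [] (describeFront G a b ++ (w ++ describeBack G b)) [] [] [] [] []) :=
    RunsIn.loop (fun j => contents [] _ [] [] (ones j) [] [])
      (fun j _ => ⟨ones j, rfl, .emit (by simp [contents])⟩) (by simp [contents])
      (by simp [contents])
  have h := h1.seq (h2.seq (h3.seq (h4.seq (h5.seq (h6.seq (h7.seq h8))))))
  rw [id, id, h0, h0', hr, describe, List.append_assoc]
  refine RunsIn.mono h ?_
  simp only [Polynomial.eval_add, Polynomial.eval_mul, Polynomial.eval_pow, Polynomial.eval_X,
    Polynomial.eval_ofNat]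
  have ha : a * (15 * a + 27) ≤ x.length * (15 * x.length + 27) := by gcongr <;> omega
  have hb : b * (15 * b + 22) ≤ x.length * (15 * x.length + 22) := by gcongr <;> omega
  nlinarith

end Programs

section DiamondNorm

open Matrix
open scoped Kronecker ComplexOrder

/-! ### Singular values -/

section SingularValues

variable {I J : Type} [Fintype I] [DecidableEq I] [Fintype J]

/-- The spectral theorem, in terms of matrix products. -/
theorem exists_diagonalization {A : Op I} (hA : A.IsHermitian) :
    ∃ W : Op I, Wᴴ * W = 1 ∧ W * Wᴴ = 1 ∧
      Wᴴ * A * W = Matrix.diagonal fun i => (hA.eigenvalues i : ℂ) := by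
  refine ⟨hA.eigenvectorUnitary, Unitary.coe_star_mul_self _, Unitary.coe_mul_star_self _, ?_⟩
  have h := hA.conjStarAlgAut_star_eigenvectorUnitary
  rwa [Unitary.conjStarAlgAut_star_apply] at h

theorem traceNorm_eq_sum {X : Op I} {W : Op I} (hW : Wᴴ * W = 1) (d : I → ℝ)
    (h : Xᴴ * X = W * Matrix.diagonal (fun i => (d i : ℂ)) * Wᴴ) :
    traceNorm X = ∑ i, √(d i) := by
  have hX := Matrix.isHermitian_conjTranspose_mul_self X
  have h1 : (Xᴴ * X).charpoly.roots = Multiset.map (fun i => (d i : ℂ)) Finset.univ.val := by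
    rw [h, Matrix.charpoly_mul_comm, ← Matrix.mul_assoc, hW, Matrix.one_mul,
      Matrix.charpoly_diagonal, Polynomial.roots_prod _ _ (by
        simp [Finset.prod_ne_zero_iff, Polynomial.X_sub_C_ne_zero])]
    simp
  rw [hX.roots_charpoly_eq_eigenvalues] at h1
  have h2 := congrArg (fun s => (s.map fun z : ℂ => √z.re).sum) h1
  simp only [Multiset.map_map, Function.comp_def] at h2
  exact h2

/-- The singular value decomposition: the columns of `M W` are multiples, by the singular values
`s`, of the columns of `U`, which are orthonormal except that some of them may vanish. -/
theorem exists_svd (M : Matrix J I ℂ) :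
    ∃ (W : Op I) (U : Matrix J I ℂ) (χ : I → ℝ), Wᴴ * W = 1 ∧ W * Wᴴ = 1 ∧
      M * W = U * Matrix.diagonal (fun i =>
        ((√((Matrix.isHermitian_conjTranspose_mul_self M).eigenvalues i) : ℝ) : ℂ)) ∧
      Uᴴ * U = Matrix.diagonal (fun i => (χ i : ℂ)) ∧ (∀ i, χ i ≤ 1) ∧
      ∀ i, χ i * √((Matrix.isHermitian_conjTranspose_mul_self M).eigenvalues i) =
        √((Matrix.isHermitian_conjTranspose_mul_self M).eigenvalues i) := by
  obtain ⟨W, hW, hW', hd⟩ := exists_diagonalization (Matrix.isHermitian_conjTranspose_mul_self M)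
  have hnn : ∀ i, 0 ≤ (Matrix.isHermitian_conjTranspose_mul_self M).eigenvalues i :=
    Matrix.eigenvalues_conjTranspose_mul_self_nonneg M
  generalize (Matrix.isHermitian_conjTranspose_mul_self M).eigenvalues = d at hd hnn
  have hN : (M * W)ᴴ * (M * W) = Matrix.diagonal fun i => (d i : ℂ) := by
    rw [← hd, Matrix.conjTranspose_mul]
    simp only [Matrix.mul_assoc]
  have hs : ∀ i, √(d i) * √(d i) = d i := fun i => Real.mul_self_sqrt (hnn i)
  have hχ : ∀ i, √(d i) ≠ 0 → (√(d i))⁻¹ * d i * (√(d i))⁻¹ = 1 := by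
    intro i h0
    rw [mul_assoc, mul_comm, mul_assoc, ← mul_inv, hs, mul_inv_cancel₀]
    exact fun h => h0 (by rw [h, Real.sqrt_zero])
  refine ⟨W, M * W * Matrix.diagonal (fun i => (((√(d i))⁻¹ : ℝ) : ℂ)),
    fun i => (√(d i))⁻¹ * d i * (√(d i))⁻¹, hW, hW', ?_, ?_, ?_, ?_⟩
  · rw [Matrix.mul_assoc, Matrix.diagonal_mul_diagonal]
    ext j i
    rw [Matrix.mul_diagonal]
    by_cases h0 : d i = 0
    · -- a column of norm zero vanishes
      have hz : ∑ j, star ((M * W) j i) * (M * W) j i = 0 := by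
        have := congrFun (congrFun hN i) i
        rw [Matrix.diagonal_apply_eq, h0] at this
        simpa only [Matrix.mul_apply (M := (M * W)ᴴ), Matrix.conjTranspose_apply,
          Complex.ofReal_zero] using this
      have hz' : ∑ j, Complex.normSq ((M * W) j i) = 0 := by
        have h1 : ((∑ j, Complex.normSq ((M * W) j i) : ℝ) : ℂ) = 0 := by
          rw [← hz, Complex.ofReal_sum]
          exact Finset.sum_congr rfl fun j _ => Complex.normSq_eq_conj_mul_self
        exact_mod_cast h1
      have := (Finset.sum_eq_zero_iff_of_nonneg fun j _ => Complex.normSq_nonneg _).mp hz' j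
        (Finset.mem_univ j)
      rw [Complex.normSq_eq_zero.mp this, zero_mul]
    · have h1 : √(d i) ≠ 0 := (Real.sqrt_ne_zero (hnn i)).mpr h0
      rw [← Complex.ofReal_mul, inv_mul_cancel₀ h1, Complex.ofReal_one, mul_one]
  · rw [Matrix.conjTranspose_mul, Matrix.diagonal_conjTranspose, Matrix.mul_assoc,
      ← Matrix.mul_assoc (M * W)ᴴ, hN, Matrix.diagonal_mul_diagonal, Matrix.diagonal_mul_diagonal]
    congr 1
    ext i
    simp [mul_assoc]
  · intro i
    by_cases h0 : √(d i) = 0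
    · simp [h0]
    · exact (hχ i h0).le
  · intro i
    by_cases h0 : √(d i) = 0
    · simp [h0]
    · exact (congrArg (· * √(d i)) (hχ i h0)).trans (one_mul _)

/-- A positive semidefinite operator is of the form `B† B`. -/
theorem exists_conjTranspose_mul_self {A : Op I} (hA : A.PosSemidef) :
    ∃ B : Op I, A = Bᴴ * B := by
  obtain ⟨W, hW, hW', hd⟩ := exists_diagonalization hA.isHermitian
  have hnn := hA.eigenvalues_nonneg
  refine ⟨Matrix.diagonal (fun i => ((√(hA.isHermitian.eigenvalues i) : ℝ) : ℂ)) * Wᴴ, ?_⟩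
  have h1 : A = W * (Wᴴ * A * W) * Wᴴ := by
    simp only [Matrix.mul_assoc, hW', Matrix.mul_one]
    rw [← Matrix.mul_assoc, hW', Matrix.one_mul]
  rw [Matrix.conjTranspose_mul, Matrix.conjTranspose_conjTranspose, Matrix.diagonal_conjTranspose,
    Matrix.mul_assoc, ← Matrix.mul_assoc (Matrix.diagonal _) (Matrix.diagonal _),
    Matrix.diagonal_mul_diagonal]
  conv_lhs => rw [h1, hd]
  rw [Matrix.mul_assoc]
  congr 3
  ext i
  simp only [Pi.star_apply, RCLike.star_def, Complex.conj_ofReal, ← Complex.ofReal_mul,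
    Real.mul_self_sqrt (hnn i)]

end SingularValues

/-! ### Tests -/

section Tests

variable {R : Type} [Fintype R]

/-- A test on a system: the probability of an event, as a linear function of the state. -/
def IsTest (ℓ : Op R →ₗ[ℝ] ℝ) : Prop :=
  ∀ σ : Op R, σ.PosSemidef → 0 ≤ ℓ σ ∧ ℓ σ ≤ σ.trace.re

/-- The test whether a measurement described by the operator `P` succeeds. -/
noncomputable def testOf (P : Op R) : Op R →ₗ[ℝ] ℝ where
  toFun σ := (P * σ).trace.re
  map_add' σ τ := by simp [Matrix.mul_add]
  map_smul' r σ := by simp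

theorem testOf_apply (P σ : Op R) : testOf P σ = (P * σ).trace.re := rfl

theorem trace_re_nonneg {σ : Op R} (hσ : σ.PosSemidef) : 0 ≤ σ.trace.re :=
  (Complex.le_def.mp hσ.trace_nonneg).1

variable [DecidableEq R]

theorem isTest_testOf {P : Op R} (hP : Pᴴ = P) (hP' : P * P = P) : IsTest (testOf P) := by
  have key : ∀ P : Op R, Pᴴ = P → P * P = P → ∀ σ : Op R, σ.PosSemidef →
      0 ≤ (P * σ).trace.re := by
    intro P hP hP' σ hσ
    have h := trace_re_nonneg (hσ.mul_mul_conjTranspose_same P)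
    rwa [hP, Matrix.mul_assoc, Matrix.trace_mul_comm, Matrix.mul_assoc, hP',
      Matrix.trace_mul_comm] at h
  intro σ hσ
  refine ⟨key P hP hP' σ hσ, ?_⟩
  have h := key (1 - P) (by simp [hP]) (by simp [sub_mul, mul_sub, hP']) σ hσ
  rw [Matrix.sub_mul, Matrix.one_mul, Matrix.trace_sub, Complex.sub_re] at h
  rw [testOf_apply]
  linarith

/-- The best test for a Hermitian operator is the projection on its positive part; if the operator
is traceless, it attains half the trace norm. -/
theorem exists_best_test {D : Op R} (hD : D.IsHermitian) :
    ∃ P : Op R, Pᴴ = P ∧ P * P = P ∧ (∀ ℓ, IsTest ℓ → ℓ D ≤ testOf P D) ∧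
      (D.trace = 0 → 2 * testOf P D = traceNorm D) := by
  obtain ⟨W, hW, hW', hd⟩ := exists_diagonalization hD
  have hDW : D = W * (Matrix.diagonal fun i => (hD.eigenvalues i : ℂ)) * Wᴴ := by
    rw [← hd]
    simp only [Matrix.mul_assoc, hW', Matrix.mul_one]
    rw [← Matrix.mul_assoc, hW', Matrix.one_mul]
  generalize hD.eigenvalues = d at hd hDW
  -- functions of `D`
  let F : (R → ℝ) → Op R := fun g => W * (Matrix.diagonal fun i => (g i : ℂ)) * Wᴴ
  have hmul : ∀ g h, F g * F h = F fun i => g i * h i := by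
    intro g h
    simp only [F, Matrix.mul_assoc]
    rw [← Matrix.mul_assoc Wᴴ, hW, Matrix.one_mul, ← Matrix.mul_assoc (Matrix.diagonal _)
      (Matrix.diagonal _), Matrix.diagonal_mul_diagonal]
    simp
  have hstar : ∀ g, (F g)ᴴ = F g := by
    intro g
    simp only [F, Matrix.conjTranspose_mul, Matrix.conjTranspose_conjTranspose,
      Matrix.diagonal_conjTranspose, Matrix.mul_assoc]
    congr 3
    ext i
    simp
  have hsub : ∀ g h, F g - F h = F fun i => g i - h i := by
    intro g h
    simp only [F, ← Matrix.sub_mul, ← Matrix.mul_sub, Matrix.diagonal_sub, Complex.ofReal_sub]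
  have htr : ∀ g, (F g).trace = ((∑ i, g i : ℝ) : ℂ) := by
    intro g
    simp only [F]
    rw [Matrix.trace_mul_comm, ← Matrix.mul_assoc, hW, Matrix.one_mul, Matrix.trace_diagonal]
    simp
  have hpos : ∀ g : R → ℝ, (∀ i, 0 ≤ g i) → (F g).PosSemidef := by
    intro g hg
    exact (Matrix.PosSemidef.diagonal fun i => by simpa using hg i).mul_mul_conjTranspose_same W
  have hF : D = F d := hDW
  let P := F fun i => if 0 < d i then 1 else 0
  have hPD : P * D = F fun i => max (d i) 0 := by
    rw [hF, hmul]
    congr 1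
    ext i
    split_ifs with h
    · rw [one_mul, max_eq_left h.le]
    · rw [zero_mul, max_eq_right (not_lt.mp h)]
  have hval : testOf P D = ∑ i, max (d i) 0 := by
    rw [testOf_apply, hPD, htr, Complex.ofReal_re]
  refine ⟨P, hstar _, ?_, ?_, ?_⟩
  · rw [hmul]
    congr 1
    ext i
    split_ifs <;> simp
  · intro ℓ hℓ
    have h1 : D = (F fun i => max (d i) 0) - F fun i => max (-d i) 0 := by
      rw [hsub, hF]
      congr 1
      ext i
      exact (max_zero_sub_max_neg_zero_eq_self (d i)).symm
    have h2 := (hℓ _ (hpos _ fun i => le_max_right (-d i) 0)).1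
    have h3 := (hℓ _ (hpos _ fun i => le_max_right (d i) 0)).2
    rw [htr, Complex.ofReal_re] at h3
    rw [hval, h1, map_sub]
    linarith
  · intro h0
    have h1 : ∑ i, d i = 0 := by
      rw [hF, htr] at h0
      exact_mod_cast h0
    have h2 : traceNorm D = ∑ i, √(d i * d i) := by
      refine traceNorm_eq_sum hW _ ?_
      rw [hF, hstar, hmul]
    have h3 : ∑ i, √(d i * d i) = ∑ i, (√(d i * d i) + d i) := by
      rw [Finset.sum_add_distrib, h1, add_zero]
    rw [h2, hval, Finset.mul_sum, h3]
    refine Finset.sum_congr rfl fun i _ => ?_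
    rw [Real.sqrt_mul_self_eq_abs]
    rcases le_total 0 (d i) with h | h
    · rw [max_eq_left h, abs_of_nonneg h]; ring
    · rw [max_eq_right h, abs_of_nonpos h]; ring

end Tests

/-! ### Pure states, private systems and off-diagonal blocks -/

section Pure

variable {R : Type}

/-- The unnormalized pure state of the vector `φ`. -/
noncomputable def pureState (φ : R → ℂ) : Op R := Matrix.vecMulVec φ (star φ)

theorem pureState_isHermitian (φ : R → ℂ) : (pureState φ).IsHermitian := by
  rw [Matrix.IsHermitian, pureState, Matrix.conjTranspose_vecMulVec, star_star]

variable [Fintype R]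

/-- The squared norm of a vector. -/
noncomputable def normSq (φ : R → ℂ) : ℝ := ∑ x, Complex.normSq (φ x)

theorem normSq_nonneg (φ : R → ℂ) : 0 ≤ normSq φ :=
  Finset.sum_nonneg fun _ _ => Complex.normSq_nonneg _

theorem normSq_smul (c : ℂ) (φ : R → ℂ) : normSq (c • φ) = Complex.normSq c * normSq φ := by
  simp [normSq, Finset.mul_sum]

theorem trace_pureState (φ : R → ℂ) : (pureState φ).trace = (normSq φ : ℂ) := by
  simp [pureState, normSq, Matrix.trace, Matrix.vecMulVec_apply, Complex.mul_conj]

theorem trace_conjTranspose_mul_self {I J : Type} [Fintype I] [Fintype J] (M : Matrix J I ℂ) :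
    (Mᴴ * M).trace = ((∑ i, normSq fun j => M j i : ℝ) : ℂ) := by
  simp [Matrix.trace, Matrix.mul_apply, normSq, Complex.normSq_eq_conj_mul_self]

theorem traceNorm_pureState [DecidableEq R] {φ : R → ℂ} (hφ : normSq φ = 1) :
    traceNorm (pureState φ) = 1 := by
  have hp : pureState φ * pureState φ = pureState φ := by
    rw [pureState, Matrix.vecMulVec_mul_vecMulVec]
    have : star φ ⬝ᵥ φ = 1 := by
      have := trace_pureState φ
      rw [hφ, pureState, Matrix.trace_vecMulVec, dotProduct_comm] at this
      simpa using this
    rw [this]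
    simp
  have hH : ((pureState φ)ᴴ * pureState φ) = pureState φ := by rw [(pureState_isHermitian φ).eq, hp]
  have h := (Matrix.isHermitian_conjTranspose_mul_self (pureState φ))
  have hid : ∀ i, h.eigenvalues i * h.eigenvalues i = h.eigenvalues i := by
    obtain ⟨W, hW, hW', hd⟩ := exists_diagonalization h
    intro i
    have h1 : (Wᴴ * ((pureState φ)ᴴ * pureState φ) * W) *
        (Wᴴ * ((pureState φ)ᴴ * pureState φ) * W) = Wᴴ * ((pureState φ)ᴴ * pureState φ) * W := by
      simp only [hH, Matrix.mul_assoc]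
      rw [← Matrix.mul_assoc W, hW', Matrix.one_mul, ← Matrix.mul_assoc (pureState φ), hp]
    rw [hd, Matrix.diagonal_mul_diagonal] at h1
    have := congrFun (congrFun h1 i) i
    rw [Matrix.diagonal_apply_eq, Matrix.diagonal_apply_eq] at this
    exact_mod_cast this
  have hs : ∀ i, √(h.eigenvalues i) = h.eigenvalues i := by
    intro i
    have h0 := Matrix.eigenvalues_conjTranspose_mul_self_nonneg (pureState φ) i
    conv_lhs => rw [← hid i]
    rw [Real.sqrt_mul_self h0]
  have ht : ((∑ i, h.eigenvalues i : ℝ) : ℂ) = 1 := by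
    rw [Complex.ofReal_sum]
    refine (h.trace_eq_sum_eigenvalues).symm.trans ?_
    rw [hH, trace_pureState, hφ, Complex.ofReal_one]
  rw [traceNorm]
  simp only [hs]
  exact_mod_cast ht

end Pure

section Amplify

variable {I J K L : Type} [Fintype I] [Fintype J] [Fintype K] [Fintype L]

theorem one_kronecker_mul_apply {I L K S : Type} [Fintype I] [Fintype L] [DecidableEq I]
    (V : Matrix K L ℂ) (X : Matrix (I × L) S ℂ) (i : I) (k : K) (s : S) :
    (((1 : Matrix I I ℂ) ⊗ₖ V) * X) (i, k) s = ∑ l, V k l * X (i, l) s := by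
  rw [Matrix.mul_apply, Fintype.sum_prod_type, Finset.sum_eq_single i]
  · simp
  · intro b _ hb
    simp [Matrix.one_apply_ne hb.symm]
  · simp

theorem one_kronecker_conj_apply {I L K : Type} [Fintype I] [Fintype L] [DecidableEq I]
    (V : Matrix K L ℂ) (X : Op (I × L)) (i i' : I) (k k' : K) :
    (((1 : Matrix I I ℂ) ⊗ₖ V) * X * ((1 : Matrix I I ℂ) ⊗ₖ V)ᴴ) (i, k) (i', k') =
      ∑ l', ∑ l, V k l * star (V k' l') * X (i, l) (i', l') := by
  rw [Matrix.mul_apply, Fintype.sum_prod_type, Finset.sum_eq_single i']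
  · refine Finset.sum_congr rfl fun l' _ => ?_
    rw [one_kronecker_mul_apply, Finset.sum_mul]
    refine Finset.sum_congr rfl fun l _ => ?_
    simp only [Matrix.conjTranspose_apply, Matrix.kroneckerMap_apply, Matrix.one_apply_eq, one_mul]
    ring
  · intro b _ hb
    refine Finset.sum_eq_zero fun l' _ => ?_
    simp [Matrix.one_apply_ne hb.symm]
  · simp

/-- A transformation of the first part of a system commutes with operations on the second part. -/
theorem ampR_one_kronecker_conj {I J L K : Type} [Fintype I] [Fintype J] [Fintype L]
    [DecidableEq I] [DecidableEq J] (Δ : Transf I J) (V : Matrix K L ℂ) (X : Op (I × L)) :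
    ampR K Δ (((1 : Matrix I I ℂ) ⊗ₖ V) * X * ((1 : Matrix I I ℂ) ⊗ₖ V)ᴴ) =
      ((1 : Matrix J J ℂ) ⊗ₖ V) * ampR L Δ X * ((1 : Matrix J J ℂ) ⊗ₖ V)ᴴ := by
  ext ⟨j, k⟩ ⟨j', k'⟩
  rw [one_kronecker_conj_apply]
  change Δ (Matrix.of fun i i' => (((1 : Matrix I I ℂ) ⊗ₖ V) * X *
    ((1 : Matrix I I ℂ) ⊗ₖ V)ᴴ) (i, k) (i', k')) j j' = _
  have h : (Matrix.of fun i i' => (((1 : Matrix I I ℂ) ⊗ₖ V) * X *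
      ((1 : Matrix I I ℂ) ⊗ₖ V)ᴴ) (i, k) (i', k')) =
      ∑ l', ∑ l, (V k l * star (V k' l')) • Matrix.of fun i i' => X (i, l) (i', l') := by
    ext i i'
    rw [Matrix.of_apply, one_kronecker_conj_apply]
    simp [Matrix.sum_apply]
  rw [h]
  simp only [map_sum, map_smul, Matrix.sum_apply, Matrix.smul_apply, smul_eq_mul]
  rfl

/-- The Schmidt decomposition: a vector of a system `I × K` comes, by an operation on the second
part that does not increase norms, from a vector of the same norm of the system `I × I`. -/
theorem exists_schmidt {I K : Type} [Fintype I] [Fintype K] [DecidableEq I] (φ : I × K → ℂ) :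
    ∃ (φ' : I × I → ℂ) (V : Matrix K I ℂ), normSq φ' = normSq φ ∧
      (1 - Vᴴ * V).PosSemidef ∧
      pureState φ = ((1 : Matrix I I ℂ) ⊗ₖ V) * pureState φ' * ((1 : Matrix I I ℂ) ⊗ₖ V)ᴴ := by
  -- the factors of the decomposition `M = U N` of the matrix of `φ` are `V` and the matrix of `φ'`
  let M : Matrix K I ℂ := Matrix.of fun k i => φ (i, k)
  obtain ⟨W, U, χ, hW, hW', hMW, hU, hχ, hχs⟩ := exists_svd M
  generalize (Matrix.isHermitian_conjTranspose_mul_self M).eigenvalues = d at hMW hχs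
  obtain ⟨s, hs⟩ : ∃ s : I → ℝ, ∀ i, √(d i) = s i := ⟨_, fun _ => rfl⟩
  simp only [hs] at hMW hχs
  let N : Op I := Matrix.diagonal (fun i => (s i : ℂ)) * Wᴴ
  have hM : M = U * N := by
    change M = U * (Matrix.diagonal (fun i => (s i : ℂ)) * Wᴴ)
    rw [← Matrix.mul_assoc, ← hMW, Matrix.mul_assoc, hW', Matrix.mul_one]
  have hsum : ∀ i k, φ (i, k) = ∑ l, U k l * N l i := fun i k => by
    have := congrFun (congrFun hM k) i
    rwa [Matrix.mul_apply] at this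
  have hN : Mᴴ * M = Nᴴ * N := by
    have h1 : Uᴴ * U * Matrix.diagonal (fun i => (s i : ℂ)) =
        Matrix.diagonal fun i => (s i : ℂ) := by
      rw [hU, Matrix.diagonal_mul_diagonal]
      congr 1
      ext i
      rw [← Complex.ofReal_mul, hχs]
    rw [hM, Matrix.conjTranspose_mul, Matrix.mul_assoc, ← Matrix.mul_assoc Uᴴ]
    change Nᴴ * (Uᴴ * U * (Matrix.diagonal (fun i => (s i : ℂ)) * Wᴴ)) = _
    rw [← Matrix.mul_assoc (Uᴴ * U), h1]
  refine ⟨fun x => N x.2 x.1, U, ?_, ?_, ?_⟩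
  · have h1 := trace_conjTranspose_mul_self M
    rw [hN, trace_conjTranspose_mul_self] at h1
    simp only [normSq, Fintype.sum_prod_type] at h1 ⊢
    exact_mod_cast h1
  · rw [hU, ← Matrix.diagonal_one, Matrix.diagonal_sub]
    refine Matrix.PosSemidef.diagonal fun i => ?_
    have : (0 : ℂ) ≤ ((1 - χ i : ℝ) : ℂ) := by
      exact_mod_cast sub_nonneg.mpr (hχ i)
    simpa using this
  · ext ⟨i, k⟩ ⟨i', k'⟩
    rw [one_kronecker_conj_apply, pureState, Matrix.vecMulVec_apply, Pi.star_apply, hsum, hsum,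
      star_sum, Finset.sum_mul_sum, Finset.sum_comm]
    refine Finset.sum_congr rfl fun l' _ => Finset.sum_congr rfl fun l _ => ?_
    simp only [pureState, Matrix.vecMulVec_apply, Pi.star_apply, star_mul']
    ring

/-- Operations on a part of the system that do not increase norms turn tests into tests. -/
theorem IsTest.conj {J L K : Type} [Fintype J] [Fintype L] [Fintype K] [DecidableEq J]
    [DecidableEq L] {ℓ : Op (J × K) →ₗ[ℝ] ℝ} (hℓ : IsTest ℓ) {V : Matrix K L ℂ}
    (hV : (1 - Vᴴ * V).PosSemidef) :
    ∃ ℓ' : Op (J × L) →ₗ[ℝ] ℝ, IsTest ℓ' ∧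
      ∀ σ, ℓ' σ = ℓ (((1 : Matrix J J ℂ) ⊗ₖ V) * σ * ((1 : Matrix J J ℂ) ⊗ₖ V)ᴴ) := by
  refine ⟨{ toFun := fun σ => ℓ (((1 : Matrix J J ℂ) ⊗ₖ V) * σ * ((1 : Matrix J J ℂ) ⊗ₖ V)ᴴ)
            map_add' := fun σ τ => by rw [Matrix.mul_add, Matrix.add_mul, map_add]
            map_smul' := fun r σ => by
              rw [Matrix.mul_smul, Matrix.smul_mul, map_smul, RingHom.id_apply] },
    fun σ hσ => ⟨(hℓ _ (hσ.mul_mul_conjTranspose_same _)).1, ?_⟩, fun σ => rfl⟩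
  refine (hℓ _ (hσ.mul_mul_conjTranspose_same _)).2.trans ?_
  obtain ⟨Y, hY⟩ := exists_conjTranspose_mul_self hV
  have h := trace_re_nonneg (hσ.mul_mul_conjTranspose_same ((1 : Matrix J J ℂ) ⊗ₖ Y))
  have hc : ∀ {K' : Type} [Fintype K'] (Z : Matrix K' L ℂ),
      (((1 : Matrix J J ℂ) ⊗ₖ Z) * σ * ((1 : Matrix J J ℂ) ⊗ₖ Z)ᴴ).trace =
        (((1 : Matrix J J ℂ) ⊗ₖ (Zᴴ * Z)) * σ).trace := by
    intro K' _ Z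
    rw [Matrix.trace_mul_comm, ← Matrix.mul_assoc, Matrix.conjTranspose_kronecker,
      ← Matrix.mul_kronecker_mul, Matrix.conjTranspose_one, Matrix.one_mul]
  rw [hc, ← hY, show (1 : Matrix J J ℂ) ⊗ₖ (1 - Vᴴ * V) =
      (1 : Matrix J J ℂ) ⊗ₖ (1 : Op L) - (1 : Matrix J J ℂ) ⊗ₖ (Vᴴ * V) by
        ext; simp only [Matrix.sub_apply, Matrix.kroneckerMap_apply, mul_sub],
    Matrix.one_kronecker_one, Matrix.sub_mul, Matrix.one_mul, Matrix.trace_sub,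
    Complex.sub_re, sub_nonneg] at h
  rwa [hc]

theorem trace_ampR_eq {I J K : Type} [Fintype J] [Fintype K] (Φ : Transf I J)
    (X : Op (I × K)) :
    (ampR K Φ X).trace = ∑ k, (Φ (Matrix.of fun i i' => X (i, k) (i', k))).trace := by
  simp only [Matrix.trace, Matrix.diag, Fintype.sum_prod_type]
  rw [Finset.sum_comm]
  rfl

end Amplify

section Contraction

variable {R : Type} [Fintype R] [DecidableEq R]

/-- The trace norm is attained by a contraction. -/
theorem exists_contraction_trace (Y : Op R) :
    ∃ C : Op R, (1 - C * Cᴴ).PosSemidef ∧ (C * Y).trace = (traceNorm Y : ℂ) := by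
  obtain ⟨W, U, χ, hW, hW', hYW, hU, hχ, hχs⟩ := exists_svd Y
  refine ⟨W * Uᴴ, ?_, ?_⟩
  · have h1 : 1 - W * Uᴴ * (W * Uᴴ)ᴴ = W * (Matrix.diagonal fun i => ((1 - χ i : ℝ) : ℂ)) * Wᴴ := by
      rw [Matrix.conjTranspose_mul, Matrix.conjTranspose_conjTranspose, Matrix.mul_assoc,
        ← Matrix.mul_assoc Uᴴ, hU]
      simp only [Complex.ofReal_sub, Complex.ofReal_one, ← Matrix.diagonal_sub,
        Matrix.diagonal_one, Matrix.mul_sub, Matrix.sub_mul, Matrix.mul_one, hW', Matrix.mul_assoc]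
    rw [h1]
    refine (Matrix.PosSemidef.diagonal fun i => ?_).mul_mul_conjTranspose_same W
    exact Complex.zero_le_real.mpr (sub_nonneg.mpr (hχ i))
  · rw [Matrix.mul_assoc, Matrix.trace_mul_comm, Matrix.mul_assoc, hYW, ← Matrix.mul_assoc, hU,
      Matrix.diagonal_mul_diagonal, Matrix.trace_diagonal, traceNorm, Complex.ofReal_sum]
    refine Finset.sum_congr rfl fun i _ => ?_
    rw [← Complex.ofReal_mul, hχs]

/-- In the positive semidefinite operator `[B₀ B₁]† [B₀ B₁]`, the off-diagonal block, paired with a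
contraction, is dominated by the diagonal blocks. -/
theorem two_mul_re_trace_le {S : Type} [Fintype S] {C : Op R} (hC : (1 - C * Cᴴ).PosSemidef)
    (B₀ B₁ : Matrix S R ℂ) :
    2 * (C * (B₀ᴴ * B₁)).trace.re ≤ (B₀ᴴ * B₀).trace.re + (B₁ᴴ * B₁).trace.re := by
  have h1 := trace_re_nonneg (Matrix.posSemidef_conjTranspose_mul_self (B₀ - B₁ * C))
  have h2 := trace_re_nonneg (hC.mul_mul_conjTranspose_same B₁)
  have e1 : ((B₁ * C)ᴴ * (B₁ * C)).trace = (B₁ * (C * Cᴴ) * B₁ᴴ).trace := by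
    rw [Matrix.trace_mul_comm, Matrix.conjTranspose_mul]
    simp only [Matrix.mul_assoc]
  have e2 : (B₀ᴴ * (B₁ * C)).trace = (C * (B₀ᴴ * B₁)).trace := by
    rw [Matrix.trace_mul_comm C, Matrix.mul_assoc]
  have e3 : (((B₁ * C)ᴴ) * B₀).trace.re = (C * (B₀ᴴ * B₁)).trace.re := by
    rw [← e2, ← Complex.conj_re, starRingEnd_apply, ← Matrix.trace_conjTranspose]
    simp
  have e4 : (B₁ * B₁ᴴ).trace = (B₁ᴴ * B₁).trace := Matrix.trace_mul_comm _ _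
  rw [Matrix.conjTranspose_sub, Matrix.sub_mul, Matrix.mul_sub, Matrix.mul_sub] at h1
  simp only [Matrix.trace_sub, Complex.sub_re, e1, e2, e3] at h1
  rw [Matrix.mul_sub, Matrix.sub_mul, Matrix.mul_one, Matrix.trace_sub, Complex.sub_re, e4] at h2
  linarith

/-- The test that measures the correlation, described by a contraction, of the two values of an
additional bit. -/
theorem exists_offDiagonal_test {J L : Type} [Fintype J] [DecidableEq J] [Fintype L]
    [DecidableEq L] {C : Op (J × L)} (hC : (1 - C * Cᴴ).PosSemidef) :
    ∃ ℓ : Op (J × (L × Bool)) →ₗ[ℝ] ℝ, IsTest ℓ ∧ ∀ σ, ℓ σ = 2⁻¹ * σ.trace.re +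
      (C * σ.submatrix (fun x : J × L => (x.1, x.2, false))
        fun x : J × L => (x.1, x.2, true)).trace.re := by
  let f : Bool → J × L → J × (L × Bool) := fun b x => (x.1, x.2, b)
  have htr : ∀ σ : Op (J × (L × Bool)), σ.trace =
      (σ.submatrix (f false) (f false)).trace + (σ.submatrix (f true) (f true)).trace := by
    intro σ
    simp only [Matrix.trace, Matrix.diag, Fintype.sum_prod_type, Fintype.sum_bool,
      ← Finset.sum_add_distrib, Matrix.submatrix_apply, f, add_comm]
  refine ⟨{ toFun := fun σ => 2⁻¹ * σ.trace.re +
              (C * σ.submatrix (f false) (f true)).trace.re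
            map_add' := fun σ τ => by
              have h : (σ + τ).submatrix (f false) (f true) =
                σ.submatrix (f false) (f true) + τ.submatrix (f false) (f true) := rfl
              rw [h, Matrix.mul_add, Matrix.trace_add, Matrix.trace_add, Complex.add_re,
                Complex.add_re]
              ring
            map_smul' := fun r σ => by
              have h : (r • σ).submatrix (f false) (f true) =
                r • σ.submatrix (f false) (f true) := rfl
              rw [h, Matrix.mul_smul, Matrix.trace_smul, Matrix.trace_smul, Complex.smul_re,
                Complex.smul_re, RingHom.id_apply, smul_eq_mul, smul_eq_mul, smul_eq_mul]
              ring }, fun σ hσ => ?_, fun σ => rfl⟩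
  obtain ⟨B, rfl⟩ := exists_conjTranspose_mul_self hσ
  have hsub : ∀ b b', (Bᴴ * B).submatrix (f b) (f b') =
      (B.submatrix id (f b))ᴴ * B.submatrix id (f b') := by
    intro b b'
    rfl
  have hneg : (1 - (-C) * (-C)ᴴ).PosSemidef := by simpa using hC
  have h1 := two_mul_re_trace_le hC (B.submatrix id (f false)) (B.submatrix id (f true))
  have h2 := two_mul_re_trace_le hneg (B.submatrix id (f false)) (B.submatrix id (f true))
  rw [Matrix.neg_mul, Matrix.trace_neg, Complex.neg_re] at h2
  change 0 ≤ 2⁻¹ * (Bᴴ * B).trace.re + _ ∧ 2⁻¹ * (Bᴴ * B).trace.re + _ ≤ _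
  rw [htr, Complex.add_re]
  simp only [hsub]
  constructor <;> linarith

end Contraction

/-! ### Optimal distinguishing of two operations -/

section Optimal

theorem norm_le_one_of_normSq {I : Type} [Fintype I] {φ : I → ℂ} (h : normSq φ = 1)
    (i : I) : ‖φ i‖ ≤ 1 := by
  have h1 : Complex.normSq (φ i) ≤ 1 := h ▸ Finset.single_le_sum
    (f := fun x => Complex.normSq (φ x)) (fun _ _ => Complex.normSq_nonneg _) (Finset.mem_univ i)
  rw [Complex.normSq_eq_norm_sq] at h1
  exact (sq_le_one_iff₀ (norm_nonneg _)).mp h1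

theorem norm_le_one_of_projection {I : Type} [Fintype I] {P : Op I} (hP : Pᴴ = P)
    (hP' : P * P = P) (j i : I) :
    ‖P j i‖ ≤ 1 := by
  have h : P i i = ((normSq fun k => P k i : ℝ) : ℂ) := by
    have h1 : (Pᴴ * P) i i = P i i := by rw [hP, hP']
    rw [← h1]
    simp [Matrix.mul_apply, normSq, Complex.normSq_eq_conj_mul_self]
  have hle : ∀ k, Complex.normSq (P k i) ≤ normSq fun k => P k i := fun k =>
    Finset.single_le_sum (f := fun k => Complex.normSq (P k i))
      (fun _ _ => Complex.normSq_nonneg _) (Finset.mem_univ k)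
  have hi := hle i
  generalize (normSq fun k => P k i) = p at h hi hle
  rw [h, Complex.normSq_ofReal] at hi
  have hp : p ≤ 1 := by nlinarith
  have hj := (hle j).trans hp
  rw [Complex.normSq_eq_norm_sq] at hj
  exact (sq_le_one_iff₀ (norm_nonneg _)).mp hj

theorem pureState_ofReal_smul {I : Type} (c : ℝ) (φ : I → ℂ) :
    pureState ((c : ℂ) • φ) = (c * c) • pureState φ := by
  ext x y
  simp [pureState, Matrix.vecMulVec_apply]
  ring

theorem ampR_real_smul {I J K : Type} (Δ : Transf I J) (c : ℝ) (X : Op (I × K)) :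
    ampR K Δ (c • X) = c • ampR K Δ X := by
  rw [← Complex.coe_smul, map_smul, Complex.coe_smul]

theorem continuous_test_ampR_pureState {I J : Type} [Fintype I] [Fintype J] (Δ : Transf I J) :
    Continuous fun x : (I × I → ℂ) × Op (J × I) => testOf x.2 (ampR I Δ (pureState x.1)) := by
  have h1 : Continuous (ampR I Δ) := LinearMap.continuous_of_finiteDimensional _
  have h2 : Continuous fun x : (I × I → ℂ) × Op (J × I) => pureState x.1 :=
    Continuous.matrix_vecMulVec continuous_fst continuous_fst.star
  exact Complex.continuous_re.comp (continuous_snd.matrix_mul (h1.comp h2)).matrix_trace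

variable {I J : Type} [Fintype I] [DecidableEq I] [Fintype J]

theorem isCompact_unit_vectors (I : Type) [Fintype I] : IsCompact {φ : I → ℂ | normSq φ = 1} := by
  refine (isCompact_univ_pi fun _ : I => isCompact_closedBall (0 : ℂ) 1).of_isClosed_subset
    (isClosed_eq ?_ continuous_const) fun φ hφ i _ => ?_
  · exact continuous_finsetSum _ fun i _ => Complex.continuous_normSq.comp (continuous_apply i)
  · exact mem_closedBall_zero_iff.mpr (norm_le_one_of_normSq hφ i)

theorem isCompact_projections (I : Type) [Fintype I] :
    IsCompact {P : Op I | Pᴴ = P ∧ P * P = P} := by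
  have hbox : IsCompact (Set.univ.pi fun _ => Set.univ.pi fun _ => Metric.closedBall 0 1 :
      Set (I → I → ℂ)) :=
    isCompact_univ_pi fun _ => isCompact_univ_pi fun _ => isCompact_closedBall _ _
  refine IsCompact.of_isClosed_subset (X := Op I) hbox
    ((isClosed_eq continuous_id.matrix_conjTranspose continuous_id).inter
      (isClosed_eq (continuous_id.matrix_mul continuous_id) continuous_id)) fun P hP j _ i _ => ?_
  exact mem_closedBall_zero_iff.mpr (norm_le_one_of_projection hP.1 hP.2 j i)

/-- By compactness, some pure state and some projective measurement are optimal. -/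
theorem exists_optimal_pure [Nonempty I] (Δ : Transf I J) :
    ∃ (φ : I × I → ℂ) (P : Op (J × I)), (normSq φ = 1 ∧ Pᴴ = P ∧ P * P = P) ∧
      ∀ (φ' : I × I → ℂ) (P' : Op (J × I)), normSq φ' = 1 → P'ᴴ = P' → P' * P' = P' →
        testOf P' (ampR I Δ (pureState φ')) ≤ testOf P (ampR I Δ (pureState φ)) := by
  obtain ⟨i⟩ := ‹Nonempty I›
  have hφ : normSq (Pi.single (i, i) 1 : I × I → ℂ) = 1 := by
    rw [normSq, Finset.sum_eq_single (i, i)] <;> simp +contextual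
  let f : (I × I → ℂ) × Op (J × I) → ℝ := fun x => testOf x.2 (ampR I Δ (pureState x.1))
  have hS : IsCompact ({φ : I × I → ℂ | normSq φ = 1} ×ˢ {P : Op (J × I) | Pᴴ = P ∧ P * P = P}) :=
    (isCompact_unit_vectors (I × I)).prod (isCompact_projections (J × I))
  have hf : ContinuousOn f
      ({φ : I × I → ℂ | normSq φ = 1} ×ˢ {P : Op (J × I) | Pᴴ = P ∧ P * P = P}) :=
    (continuous_test_ampR_pureState Δ).continuousOn
  have hne : ({φ : I × I → ℂ | normSq φ = 1} ×ˢ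
      {P : Op (J × I) | Pᴴ = P ∧ P * P = P}).Nonempty :=
    Set.Nonempty.prod ⟨_, hφ⟩ ⟨0, Matrix.conjTranspose_zero, Matrix.zero_mul 0⟩
  obtain ⟨x, hx, hmax⟩ := hS.exists_isMaxOn hne hf
  refine ⟨x.1, x.2, ⟨hx.1, hx.2⟩, fun φ' P' h1 h2 h3 => ?_⟩
  exact isMaxOn_iff.mp hmax (φ', P') (Set.mk_mem_prod h1 ⟨h2, h3⟩)

variable [DecidableEq J] {Δ : Transf I J} {M : ℝ}

/-- If `M` bounds the success of projective measurements on unit vectors of `I × I`, it bounds the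
success of tests on vectors with an arbitrary second part. -/
theorem test_pure_le (hΔ : ∀ X, Δ Xᴴ = (Δ X)ᴴ)
    (hM : ∀ (φ : I × I → ℂ) (P : Op (J × I)), normSq φ = 1 → Pᴴ = P → P * P = P →
      testOf P (ampR I Δ (pureState φ)) ≤ M)
    {K : Type} [Fintype K] (φ : I × K → ℂ) {ℓ : Op (J × K) →ₗ[ℝ] ℝ} (hℓ : IsTest ℓ) :
    ℓ (ampR K Δ (pureState φ)) ≤ M * normSq φ := by
  obtain ⟨φ', V, hφ', hV, hpure⟩ := exists_schmidt φ
  obtain ⟨ℓ', hℓ', hconj⟩ := hℓ.conj hV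
  rw [hpure, ampR_one_kronecker_conj, ← hconj, ← hφ']
  have h0 := normSq_nonneg φ'
  rcases h0.eq_or_lt with h0 | h0
  · have hz : φ' = 0 := by
      funext i
      exact Complex.normSq_eq_zero.mp ((Finset.sum_eq_zero_iff_of_nonneg
        fun _ _ => Complex.normSq_nonneg _).mp h0.symm i (Finset.mem_univ i))
    rw [← h0, hz, pureState, Matrix.zero_vecMulVec, map_zero, map_zero, mul_zero]
  -- otherwise `φ'` is a multiple of a unit vector
  · have hs : √(normSq φ') * √(normSq φ') = normSq φ' := Real.mul_self_sqrt h0.le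
    have hs0 : √(normSq φ') ≠ 0 := (Real.sqrt_pos.mpr h0).ne'
    let ψ : I × I → ℂ := (((√(normSq φ'))⁻¹ : ℝ) : ℂ) • φ'
    have hψ : normSq ψ = 1 := by
      rw [normSq_smul, Complex.normSq_ofReal, ← mul_inv, hs, inv_mul_cancel₀ h0.ne']
    have hφψ : pureState φ' = normSq φ' • pureState ψ := by
      rw [pureState_ofReal_smul, smul_smul, ← mul_inv, hs, mul_inv_cancel₀ h0.ne', one_smul]
    rw [hφψ, ampR_real_smul, map_smul, smul_eq_mul, mul_comm M]
    refine mul_le_mul_of_nonneg_left ?_ h0.le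
    obtain ⟨P, hP, hP', hbest, -⟩ := exists_best_test (D := ampR I Δ (pureState ψ)) (by
      rw [Matrix.IsHermitian, ← conjTranspose_ampR hΔ, (pureState_isHermitian ψ).eq])
    exact (hbest ℓ' hℓ').trans (hM ψ P hψ hP hP')

/-- The same bound holds for mixed states, which are mixtures of pure states. -/
theorem test_density_le (hΔ : ∀ X, Δ Xᴴ = (Δ X)ᴴ)
    (hM : ∀ (φ : I × I → ℂ) (P : Op (J × I)), normSq φ = 1 → Pᴴ = P → P * P = P →
      testOf P (ampR I Δ (pureState φ)) ≤ M)
    {K : Type} [Fintype K] [DecidableEq K] {ρ : Op (I × K)} (hρ : IsDensity ρ)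
    {ℓ : Op (J × K) →ₗ[ℝ] ℝ} (hℓ : IsTest ℓ) : ℓ (ampR K Δ ρ) ≤ M := by
  obtain ⟨B, hB⟩ := exists_conjTranspose_mul_self hρ.1
  have h1 : ρ = ∑ r, pureState (star (B r)) := by
    rw [hB]
    ext x y
    simp [Matrix.mul_apply, Matrix.sum_apply, pureState, Matrix.vecMulVec_apply]
  have h2 : ∑ r, normSq (star (B r)) = 1 := by
    have h3 := congrArg Matrix.trace h1
    rw [hρ.2, Matrix.trace_sum] at h3
    simp only [trace_pureState] at h3
    exact_mod_cast h3.symm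
  calc ℓ (ampR K Δ ρ) = ∑ r, ℓ (ampR K Δ (pureState (star (B r)))) := by
        rw [h1, map_sum, map_sum]
    _ ≤ ∑ r, M * normSq (star (B r)) :=
        Finset.sum_le_sum fun r _ => test_pure_le hΔ hM _ hℓ
    _ = M := by rw [← Finset.mul_sum, h2, mul_one]

/-- Rank one operators that are not Hermitian are controlled by a pure state with an additional
qubit, in which the two vectors are superposed. -/
theorem re_trace_mul_ampR_le (hΔ : ∀ X, Δ Xᴴ = (Δ X)ᴴ) (hΔ0 : ∀ X, (Δ X).trace = 0)
    (hM : ∀ (φ : I × I → ℂ) (P : Op (J × I)), normSq φ = 1 → Pᴴ = P → P * P = P →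
      testOf P (ampR I Δ (pureState φ)) ≤ M)
    {C : Op (J × I)} (hC : (1 - C * Cᴴ).PosSemidef) (u w : I × I → ℂ) :
    (C * ampR I Δ (Matrix.vecMulVec u (star w))).trace.re ≤ M * (normSq u + normSq w) := by
  obtain ⟨ℓ, hℓ, hℓC⟩ := exists_offDiagonal_test hC
  let ψ : I × (I × Bool) → ℂ := fun x => cond x.2.2 (w (x.1, x.2.1)) (u (x.1, x.2.1))
  have h := test_pure_le hΔ hM ψ hℓ
  have hn : normSq ψ = normSq u + normSq w := by
    simp [normSq, Fintype.sum_prod_type, Finset.sum_add_distrib, ψ, add_comm]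
  have ht : (ampR (I × Bool) Δ (pureState ψ)).trace = 0 := by
    rw [trace_ampR_eq]
    exact Finset.sum_eq_zero fun k _ => hΔ0 _
  rw [hℓC, ht, Complex.zero_re, mul_zero, zero_add, hn] at h
  exact h

/-- By the singular value decomposition and duality, the bound on rank one operators bounds the
trace norm of the image of every operator. -/
theorem traceNorm_ampR_le (hΔ : ∀ X, Δ Xᴴ = (Δ X)ᴴ) (hΔ0 : ∀ X, (Δ X).trace = 0)
    (hM : ∀ (φ : I × I → ℂ) (P : Op (J × I)), normSq φ = 1 → Pᴴ = P → P * P = P →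
      testOf P (ampR I Δ (pureState φ)) ≤ M)
    {X : Op (I × I)} (hX : traceNorm X = 1) : traceNorm (ampR I Δ X) ≤ 2 * M := by
  obtain ⟨C, hC, hCY⟩ := exists_contraction_trace (ampR I Δ X)
  obtain ⟨W, U, χ, hW, hW', hXW, hU, hχ, hχs⟩ := exists_svd X
  rw [traceNorm] at hX
  have hs0 : ∀ k, 0 ≤ √((Matrix.isHermitian_conjTranspose_mul_self X).eigenvalues k) :=
    fun k => Real.sqrt_nonneg _
  obtain ⟨s, hs⟩ : ∃ s : I × I → ℝ,
    ∀ k, √((Matrix.isHermitian_conjTranspose_mul_self X).eigenvalues k) = s k := ⟨_, fun _ => rfl⟩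
  simp only [hs] at hX hXW hχs hs0
  have hXsum : X = ∑ k, s k • Matrix.vecMulVec (fun x => U x k) (star fun x => W x k) := by
    have h1 : X = U * Matrix.diagonal (fun k => (s k : ℂ)) * Wᴴ := by
      rw [← hXW, Matrix.mul_assoc, hW', Matrix.mul_one]
    rw [h1]
    ext x y
    simp only [Matrix.mul_apply (N := Wᴴ), Matrix.mul_diagonal, Matrix.conjTranspose_apply,
      Matrix.sum_apply, Matrix.smul_apply, Matrix.vecMulVec_apply, Pi.star_apply,
      Complex.real_smul]
    exact Finset.sum_congr rfl fun k _ => by ring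
  have hcol : ∀ (Z : Op (I × I)) (d : I × I → ℝ), Zᴴ * Z = Matrix.diagonal (fun k => (d k : ℂ)) →
      ∀ k, normSq (fun x => Z x k) = d k := by
    intro Z d hZ k
    have := congrFun (congrFun hZ k) k
    rw [Matrix.diagonal_apply_eq, Matrix.mul_apply] at this
    simp only [Matrix.conjTranspose_apply, Complex.star_def, ← Complex.normSq_eq_conj_mul_self]
      at this
    exact_mod_cast this
  have hWn := hcol W (fun _ => 1) (by rw [hW]; simp)
  have hUn := hcol U χ hU
  have hsum : traceNorm (ampR I Δ X) = ∑ k, s k *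
      (C * ampR I Δ (Matrix.vecMulVec (fun x => U x k) (star fun x => W x k))).trace.re := by
    have h1 := congrArg Complex.re hCY
    rw [Complex.ofReal_re] at h1
    rw [← h1]
    conv_lhs => rw [hXsum]
    rw [map_sum, Matrix.mul_sum, Matrix.trace_sum, Complex.re_sum]
    refine Finset.sum_congr rfl fun k _ => ?_
    rw [ampR_real_smul, Matrix.mul_smul, Matrix.trace_smul, Complex.smul_re, smul_eq_mul]
  calc traceNorm (ampR I Δ X) ≤ ∑ k, s k * (M * (χ k + 1)) := by
        rw [hsum]
        refine Finset.sum_le_sum fun k _ => mul_le_mul_of_nonneg_left ?_ (hs0 k)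
        have := re_trace_mul_ampR_le hΔ hΔ0 hM hC (fun x => U x k) (fun x => W x k)
        rwa [hUn, hWn] at this
    _ = ∑ k, 2 * M * s k := Finset.sum_congr rfl fun k _ => by
        linear_combination M * hχs k
    _ = 2 * M := by rw [← Finset.mul_sum, hX, mul_one]

/-- For a transformation that annihilates traces and preserves adjoints, such as a difference of
admissible operations, half the diamond norm is the maximum, over all states and all tests, of the
difference that the transformation makes to a test. It is attained by a pure state of two copies of
the input and a projective measurement. -/
theorem exists_diamondNorm [Nonempty I] (hΔ : ∀ X, Δ Xᴴ = (Δ X)ᴴ) (hΔ0 : ∀ X, (Δ X).trace = 0) :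
    (∃ (φ : I × I → ℂ) (P : Op (J × I)), normSq φ = 1 ∧ Pᴴ = P ∧ P * P = P ∧
      2 * testOf P (ampR I Δ (pureState φ)) = diamondNorm Δ) ∧
    ∀ (K : Type) [Fintype K] [DecidableEq K] (ρ : Op (I × K)) (ℓ : Op (J × K) →ₗ[ℝ] ℝ),
      IsDensity ρ → IsTest ℓ → 2 * ℓ (ampR K Δ ρ) ≤ diamondNorm Δ := by
  obtain ⟨φ, P, ⟨hφ, hP, hP'⟩, hM⟩ := exists_optimal_pure Δ
  have hmax : traceNorm (ampR I Δ (pureState φ)) = 2 * testOf P (ampR I Δ (pureState φ)) := by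
    obtain ⟨P', h1, h2, h3, h4⟩ := exists_best_test (D := ampR I Δ (pureState φ)) (by
      rw [Matrix.IsHermitian, ← conjTranspose_ampR hΔ, (pureState_isHermitian φ).eq])
    rw [← h4 (by rw [trace_ampR_eq]; exact Finset.sum_eq_zero fun k _ => hΔ0 _),
      le_antisymm (hM φ P' hφ h1 h2) (h3 _ (isTest_testOf hP hP'))]
  have hd : diamondNorm Δ = 2 * testOf P (ampR I Δ (pureState φ)) := by
    refine IsGreatest.csSup_eq ⟨⟨pureState φ, traceNorm_pureState hφ, hmax⟩, ?_⟩
    rintro r ⟨X, hX, rfl⟩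
    exact traceNorm_ampR_le hΔ hΔ0 hM hX
  refine ⟨⟨φ, P, hφ, hP, hP', hd.symm⟩, fun K _ _ ρ ℓ hρ hℓ => ?_⟩
  rw [hd]
  exact mul_le_mul_of_nonneg_left (test_density_le hΔ hM hρ hℓ) zero_le_two

end Optimal

/-! ### The acceptance probability -/

section Acceptance

variable {n m w w' : ℕ}

/-- The joint state in which the verifier's private qubit holds `i` and all other qubits are in the
state `σ i`, for `i` chosen uniformly. -/
noncomputable def coinMixture {R : Type} (σ : Bool → Op R) : Op (Bits 1 × R) :=
  (1 / 2 : ℂ) • (Matrix.single (fun _ => false) (fun _ => false) 1 ⊗ₖ σ false) +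
    (1 / 2 : ℂ) • (Matrix.single (fun _ => true) (fun _ => true) 1 ⊗ₖ σ true)

theorem turn_tasteChallenge (Φ₀ Φ₁ : Transf (Bits n) (Bits m))
    (Φ : Transf (Bits 0 × Bits 0) (Bits n × Bits w)) :
    rename (Equiv.prodAssoc (Bits 1) (Bits m) (Bits w))
        (turn Φ (tasteChallenge Φ₀ Φ₁) (1 : Op (Bits 0 × (Bits 0 × Bits 0)))) =
      coinMixture fun i => ampR (Bits w) (cond i Φ₁ Φ₀) (Φ 1) := by
  have h1 : ∀ x y : Bits 0, (Matrix.of fun i i' : Bits 0 × Bits 0 =>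
      (1 : Op (Bits 0 × (Bits 0 × Bits 0))) (x, i) (y, i')) = 1 := by
    intro x y
    obtain rfl := Subsingleton.elim x y
    ext i i'
    simp [Matrix.one_apply]
  ext ⟨b, q, k⟩ ⟨b', q', k'⟩
  change tasteChallenge Φ₀ Φ₁ (Matrix.of fun x x' => Φ (Matrix.of fun i i' =>
    (1 : Op (Bits 0 × (Bits 0 × Bits 0))) (x.1, i) (x'.1, i')) (x.2, k) (x'.2, k'))
      (b, q) (b', q') = _
  simp only [h1]
  rfl

theorem ampL_kronecker {I J K : Type} (Φ : Transf I J) (A : Op K) (X : Op I) :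
    ampL K Φ (A ⊗ₖ X) = A ⊗ₖ Φ X := by
  ext x y
  change Φ (A x.1 y.1 • X) x.2 y.2 = _
  rw [map_smul]
  rfl

theorem ampL_coinMixture {R S : Type} (Ψ : Transf R S) (σ : Bool → Op R) :
    ampL (Bits 1) Ψ (coinMixture σ) = coinMixture fun i => Ψ (σ i) := by
  simp only [coinMixture, map_add, map_smul, ampL_kronecker]

/-- The probability that the prover, holding `σ` and applying `Ψ`, answers `i`. -/
noncomputable def answerTest {R : Type} (Ψ : Transf R (Bits 1 × Bits w')) (i : Bool) :
    Op R →ₗ[ℝ] ℝ where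
  toFun σ := ∑ x, (Ψ σ (fun _ => i, x) (fun _ => i, x)).re
  map_add' σ τ := by simp [Finset.sum_add_distrib]
  map_smul' r σ := by
    rw [← Complex.coe_smul, map_smul]
    simp [Finset.mul_sum]

theorem answerTest_apply {R : Type} (Ψ : Transf R (Bits 1 × Bits w')) (i : Bool) (σ : Op R) :
    answerTest Ψ i σ = ∑ x, (Ψ σ (fun _ => i, x) (fun _ => i, x)).re := rfl

theorem answerTest_add {R : Type} (Ψ : Transf R (Bits 1 × Bits w')) (σ : Op R) :
    answerTest Ψ false σ + answerTest Ψ true σ = (Ψ σ).trace.re := by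
  rw [Matrix.trace, Fintype.sum_prod_type, ← (Equiv.funUnique (Fin 1) Bool).symm.sum_comp,
    Fintype.sum_bool, Complex.add_re, Complex.re_sum, Complex.re_sum, add_comm]
  rfl

theorem isTest_answerTest {R : Type} [Fintype R] {Ψ : Transf R (Bits 1 × Bits w')}
    (hΨ : IsAdmissible Ψ) : IsTest (answerTest Ψ false) := by
  intro σ hσ
  obtain ⟨h1, h2⟩ := hΨ.trace_of_posSemidef hσ
  have h0 : ∀ i, 0 ≤ answerTest Ψ i σ := fun i =>
    Finset.sum_nonneg fun x _ => (Complex.le_def.mp (h1.diag_nonneg (i := (fun _ => i, x)))).1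
  have h := answerTest_add Ψ σ
  rw [h2] at h
  exact ⟨h0 false, by linarith [h0 true]⟩

theorem probOne_tasteDecision {R : Type} (Ψ : Transf R (Bits 1 × Bits w')) (σ : Bool → Op R) :
    probOne (ampR (Bits w') tasteDecision (rename (Equiv.prodAssoc (Bits 1) (Bits 1) (Bits w')).symm
      (coinMixture fun i => Ψ (σ i)))) =
      (answerTest Ψ false (σ false) + answerTest Ψ true (σ true)) / 2 := by
  have h : ∀ x, ampR (Bits w') tasteDecision
      (rename (Equiv.prodAssoc (Bits 1) (Bits 1) (Bits w')).symm (coinMixture fun i => Ψ (σ i)))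
        (fun _ => true, x) (fun _ => true, x) =
      ∑ i : Bool, ∑ j : Bool, if (i == j) = true then
        (coinMixture fun i => Ψ (σ i)) (fun _ => i, (fun _ => j, x)) (fun _ => i, (fun _ => j, x))
      else 0 := fun x => Matrix.diagonal_apply_eq (fun out : Bits 1 =>
    ∑ i : Bool, ∑ j : Bool, if (i == j) = out 0 then
      (coinMixture fun i => Ψ (σ i)) (fun _ => i, (fun _ => j, x)) (fun _ => i, (fun _ => j, x))
    else 0) fun _ => true
  have hne : (fun _ => true : Bits 1) ≠ fun _ => false := fun h => by
    simpa using congrFun h 0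
  simp only [probOne, h, answerTest_apply]
  simp [coinMixture, hne, hne.symm, Matrix.single_apply, ← Finset.mul_sum,
    Finset.sum_add_distrib]
  ring

theorem acceptProb_blindTasteTest (Q₀ Q₁ : Transf (Bits n) (Bits m))
    (hQ₁ : ∀ X, (Q₁ X).trace = X.trace)
    {Φ : Transf (Bits 0 × Bits 0) (Bits n × Bits w)} (hΦ : IsAdmissible Φ)
    {Ψ : Transf (Bits m × Bits w) (Bits 1 × Bits w')} (hΨ : IsAdmissible Ψ) :
    (blindTasteTest Q₀ Q₁).acceptProb (.round w Φ hΦ (.decide w' Ψ hΨ)) =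
      1 / 2 + answerTest Ψ false (ampR (Bits w) (Q₀ - Q₁) (Φ 1)) / 2 := by
  change probOne (ampR (Bits w') tasteDecision (rename
    (Equiv.prodAssoc (Bits 1) (Bits 1) (Bits w')).symm (ampL (Bits 1) Ψ
      (rename (Equiv.prodAssoc (Bits 1) (Bits m) (Bits w))
        (turn Φ (tasteChallenge Q₀ Q₁) (1 : Op (Bits 0 × (Bits 0 × Bits 0)))))))) = _
  rw [turn_tasteChallenge, ampL_coinMixture, probOne_tasteDecision]
  have h1 : ampR (Bits w) (Q₀ - Q₁) (Φ 1) = ampR (Bits w) Q₀ (Φ 1) - ampR (Bits w) Q₁ (Φ 1) := rfl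
  have h2 := answerTest_add Ψ (ampR (Bits w) Q₁ (Φ 1))
  have h3 : (1 : Op (Bits 0 × Bits 0)).trace = 1 := by simp
  rw [hΨ.preservesTraceStar.trace, trace_ampR hQ₁, hΦ.preservesTraceStar.trace, h3,
    Complex.one_re] at h2
  rw [h1, map_sub]
  simp only [cond_false, cond_true]
  linarith

end Acceptance

/-! ### Optimal provers -/

section Provers

/-- Preparing a pure state is admissible. -/
theorem exists_admissible_prepare {I R : Type} [Fintype I] [DecidableEq I] [Unique I] [Fintype R]
    {φ : R → ℂ} (hφ : normSq φ = 1) : ∃ Φ : Transf I R, IsAdmissible Φ ∧ Φ 1 = pureState φ := by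
  refine ⟨kraus fun _ : Unit => Matrix.of fun r _ => φ r, isAdmissible_kraus ?_, ?_⟩
  · ext i i'
    obtain rfl := Subsingleton.elim i i'
    have h : ((normSq φ : ℝ) : ℂ) = 1 := by rw [hφ, Complex.ofReal_one]
    rw [Matrix.one_apply_eq, ← h]
    simp [Matrix.mul_apply, normSq, Complex.normSq_eq_conj_mul_self]
  · ext r r'
    simp [kraus_apply_apply, Matrix.one_apply, pureState, Matrix.vecMulVec_apply]

/-- A projective measurement, whose outcome is stored in a qubit, is admissible. -/
theorem exists_admissible_measure {R : Type} [Fintype R] [DecidableEq R] {P : Op R} (hP : Pᴴ = P)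
    (hP' : P * P = P) :
    ∃ Ψ : Transf R (Bits 1 × Bits 0), IsAdmissible Ψ ∧
      ∀ σ, answerTest Ψ false σ = testOf P σ := by
  -- the outcome `false` stands for `P`, the outcome `true` for its complement
  let B : Bool → Op R := fun i => cond i (1 - P) P
  let K : Bool × R → Matrix (Bits 1 × Bits 0) R ℂ := fun e =>
    Matrix.of fun x r => if x.1 0 = e.1 then B e.1 e.2 r else 0
  refine ⟨kraus K, isAdmissible_kraus ?_, fun σ => ?_⟩
  · have h1 : ∑ i, (B i)ᴴ * B i = 1 := by
      simp [B, hP, Matrix.mul_sub, Matrix.sub_mul, hP']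
    rw [← h1, Fintype.sum_prod_type]
    refine Finset.sum_congr rfl fun i _ => ?_
    ext r r'
    simp only [Matrix.sum_apply, Matrix.mul_apply, Matrix.conjTranspose_apply, K, Matrix.of_apply]
    refine Finset.sum_congr rfl fun s _ => ?_
    rw [Fintype.sum_prod_type, ← (Equiv.funUnique (Fin 1) Bool).symm.sum_comp]
    cases i <;> simp
  · have h1 : ∀ x : Bits 0, kraus K σ (fun _ => false, x) (fun _ => false, x) =
        (P * σ * Pᴴ).trace := by
      intro x
      simp [kraus_apply_apply, Fintype.sum_prod_type, K, B, Matrix.trace, Matrix.mul_apply,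
        Finset.sum_mul]
    rw [answerTest_apply, Fintype.sum_unique, h1, testOf_apply, hP, Matrix.trace_mul_comm,
      ← Matrix.mul_assoc, hP']

/-- The maximum acceptance probability of the blind taste-test. -/
theorem isGreatest_acceptProb {n m : ℕ} {Q₀ Q₁ : Transf (Bits n) (Bits m)}
    (h₀ : PreservesTraceStar Q₀) (h₁ : PreservesTraceStar Q₁) :
    IsGreatest {r : ℝ | ∃ P : (blindTasteTest Q₀ Q₁).Prover,
        (blindTasteTest Q₀ Q₁).acceptProb P = r}
      (1 / 2 + diamondNorm (Q₀ - Q₁) / 4) := by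
  obtain ⟨⟨φ, P, hφ, hP, hP', hmax⟩, hle⟩ := exists_diamondNorm (Δ := Q₀ - Q₁)
    (fun X => by
      rw [LinearMap.sub_apply, LinearMap.sub_apply, h₀.conjTranspose, h₁.conjTranspose,
        Matrix.conjTranspose_sub])
    (fun X => by
      rw [LinearMap.sub_apply, Matrix.trace_sub, h₀.trace, h₁.trace, sub_self])
  constructor
  -- the prover sends the first copy of the input space and keeps the second one
  · let _ : Unique (Bits 0 × Bits 0) := Unique.mk' _
    obtain ⟨Φ, hΦ, hΦ1⟩ := exists_admissible_prepare (I := Bits 0 × Bits 0) hφ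
    obtain ⟨Ψ, hΨ, hΨP⟩ := exists_admissible_measure hP hP'
    refine ⟨.round n Φ hΦ (.decide 0 Ψ hΨ), ?_⟩
    rw [acceptProb_blindTasteTest _ _ h₁.trace, hΨP, hΦ1]
    linarith
  · rintro r ⟨S, rfl⟩
    obtain ⟨w, Φ, hΦ, w', Ψ, hΨ, rfl⟩ : ∃ (w : ℕ) (Φ : Transf (Bits 0 × Bits 0) (Bits n × Bits w))
        (hΦ : IsAdmissible Φ) (w' : ℕ) (Ψ : Transf (Bits m × Bits w) (Bits 1 × Bits w'))
        (hΨ : IsAdmissible Ψ), S = .round w Φ hΦ (.decide w' Ψ hΨ) := by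
      rcases S with _ | ⟨w, Φ, hΦ, T⟩
      rcases T with ⟨w', Ψ, hΨ⟩
      exact ⟨w, Φ, hΦ, w', Ψ, hΨ, rfl⟩
    rw [acceptProb_blindTasteTest _ _ h₁.trace]
    have hρ : IsDensity (Φ 1) := hΦ.isDensity ⟨Matrix.PosSemidef.one, by simp⟩
    have := hle _ _ _ hρ (isTest_answerTest hΨ)
    linarith

end Provers

end DiamondNorm

end BlindTaste

open BlindTaste in
/-- For every reasonable finite gate set and all constants `0 ≤ b < a ≤ 2`, the quantum circuit
distinguishability problem is in `QIP`; the blind taste-test verifier is a three-message quantum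
interactive proof system for it with completeness `1/2 + a/4` and soundness `1/2 + b/4`; and the
maximum probability with which a prover can cause that verifier to accept is exactly
`1/2 + ‖Q₀ - Q₁‖_⋄ / 4`. -/
theorem theorem3p1 (G : GateSet) (hG : G.Reasonable) (a b : ℝ) (hb : 0 ≤ b) (hab : b < a)
    (ha : a ≤ 2) :
    QCD G a b hab ∈ QIP ∧
    (∃ (H : GateSet) (f : List Bool → List Bool), H.Reasonable ∧
      IsProofSystem H f (QCD G a b hab) (fun _ => 3) (1 / 2 + a / 4) (1 / 2 + b / 4) ∧
      ∀ (n m : ℕ) (Q₀ Q₁ : Circuit G n m), ∃ W : VerifierCircuits H 0,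
        f (encodePair Q₀ Q₁) = W.encode ∧ W.toVerifier = blindTasteTest Q₀.op Q₁.op) ∧
    ∀ (n m : ℕ) (Q₀ Q₁ : Circuit G n m),
      IsGreatest {r : ℝ | ∃ P : (blindTasteTest Q₀.op Q₁.op).Prover,
          (blindTasteTest Q₀.op Q₁.op).acceptProb P = r}
        (1 / 2 + diamondNorm (Q₀.op - Q₁.op) / 4) := by
  have hmax : ∀ (n m : ℕ) (Q₀ Q₁ : Circuit G n m),
      IsGreatest {r : ℝ | ∃ P : (blindTasteTest Q₀.op Q₁.op).Prover,
          (blindTasteTest Q₀.op Q₁.op).acceptProb P = r}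
        (1 / 2 + diamondNorm (Q₀.op - Q₁.op) / 4) := fun n m Q₀ Q₁ =>
    isGreatest_acceptProb (preservesTraceStar_circuit Q₀) (preservesTraceStar_circuit Q₁)
  have hsys : IsProofSystem (tasteGateSet G) (reduction G) (QCD G a b hab) (fun _ => 3)
      (1 / 2 + a / 4) (1 / 2 + b / 4) := by
    refine ⟨polyTime_reduction G, fun x hx => ?_⟩
    obtain ⟨n, m, Q₀, Q₁, rfl⟩ : ∃ (n m : ℕ) (Q₀ Q₁ : Circuit G n m), x = encodePair Q₀ Q₁ := by
      rcases hx with ⟨n, m, Q₀, Q₁, h, -⟩ | ⟨n, m, Q₀, Q₁, h, -⟩ <;> exact ⟨n, m, Q₀, Q₁, h⟩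
    refine ⟨tasteVerifier Q₀ Q₁, reduction_encodePair G Q₀ Q₁, ?_⟩
    rw [tasteVerifier_toVerifier]
    refine ⟨rfl, ?_, ?_⟩
    · rintro ⟨n', m', R₀, R₁, h, hR⟩
      obtain ⟨rfl, rfl, h0, h1⟩ := encodePair_inj h
      obtain rfl := eq_of_heq h0
      obtain rfl := eq_of_heq h1
      obtain ⟨P, hP⟩ := (hmax _ _ Q₀ Q₁).1
      exact ⟨P, by rw [hP]; linarith⟩
    · rintro ⟨n', m', R₀, R₁, h, hR⟩ P
      obtain ⟨rfl, rfl, h0, h1⟩ := encodePair_inj h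
      obtain rfl := eq_of_heq h0
      obtain rfl := eq_of_heq h1
      exact ((hmax _ _ Q₀ Q₁).2 ⟨P, rfl⟩).trans (by linarith)
  have hH := tasteGateSet_reasonable G hG
  refine ⟨⟨tasteGateSet G, reduction G, fun _ => 3, Polynomial.C 3, 1 / 2 + a / 4, 1 / 2 + b / 4,
    hH, fun l => by simp, by linarith, by linarith, by linarith, hsys⟩,
    ⟨tasteGateSet G, reduction G, hH, hsys, fun n m Q₀ Q₁ =>
      ⟨tasteVerifier Q₀ Q₁, reduction_encodePair G Q₀ Q₁, tasteVerifier_toVerifier Q₀ Q₁⟩⟩,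
    hmax⟩
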